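/- Let $\{Z_t\}_{t\in\mathbb Z}$ be i.i.d. real random variables with mean $0$ and variance $1$, let $\theta,\gamma,\omega\in\mathbb R$ with $\theta,\gamma$ not both zero, and put $g(Z_t)=\theta Z_t+\gamma(|Z_t|-\mathbb E|Z_t|)$. Let $s\ge 1$ be an integer, let $d<1/2$, and let $\alpha,\beta$ be real polynomials with $\alpha(0)=\beta(0)=1$, without common complex roots, with $\beta(z)\ne0$ for all complex $|z|\le1$ and with $\alpha(1)\neq 0$. Write $$f(z)=\frac{\alpha(z)}{\beta(z)}=\sum_{k\ge0}f_kz^k,\qquad (1-z^s)^{-d}=\sum_{k\ge0}\pi_{d,k}z^k,\qquad \frac{\alpha(z)}{\beta(z)}(1-z^s)^{-d}=\sum_{k\ge0}\lambda_{d,k}z^k .$$ Let $\{X_t\}_{t\in\mathbb Z}$ be the SFIEGARCH process $X_t=\sigma_tZ_t$, where $\sigma_t>0$ and $\ln(\sigma_t^2)=\omega+\sum_{k\ge0}\lambda_{d,k}\,g(Z_{t-1-k})$ (a.s. convergent series). Assume that $Z_0\ne0$ a.s. and $\operatorname{Var}(\ln(Z_0^2))<\infty$. Put $\sigma_g^2=\theta^2+\gamma^2-(\gamma\,\mathbb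 E|Z_0|)^2+2\theta\gamma\,\mathbb E(Z_0|Z_0|)$ and $C_1=\operatorname{Cov}(g(Z_0),\ln(Z_0^2))$. For $h\in\mathbb Z$ let $\gamma_A(h)=\sum_{i\ge0}f_if_{i+|h|}$ and $$\gamma_V(sh)=\sigma_g^2\frac{(-1)^h\,\Gamma(1-2d)}{\Gamma(1-d+h)\,\Gamma(1-d-h)} .$$ For $0\le r<s$ and $k,h\in\mathbb N$ let $$\mathscr K(sk+r)=\sum_{j=0}^{\lfloor\sqrt k\rfloor}f_{sj+r}\frac{\pi_{d,sk-sj}}{\pi_{d,sk}},\qquad \mathscr G(sh+r)=\sum_{|k|\le\lfloor\sqrt h\rfloor}\gamma_A(sk+r)\frac{\gamma_V(sh-sk)}{\gamma_V(sh)}$$ (with the convention $x/0=0$), and $$\mathscr C_1(h)=\sigma_g^2\frac{\Gamma(1-2d)}{\Gamma(1-d)\Gamma(d)}\sum_{r=0}^{s-1}\mathscr G(sh+r),\qquad \mathscr C_2(h)=\frac1{\Gamma(d)}\sum_{r=0}^{s-1}\mathscr K(sh+r-1).$$ Write $a_h\sim b_h$ if $a_h-b_h=o(b_h)$ as $h\to\infty$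 (that is, $a_h/b_h\to1$ whenever $b_h\ne0$ for all large $h$). Then $\ln(X_t^2)$ is square integrable for every $t$, and its autocovariances $\gamma_{\ln X^2}(h)=\operatorname{Cov}(\ln(X_t^2),\ln(X_{t+h}^2))$ satisfy, for every $t\in\mathbb Z$, as $h\to\infty$, $$\sum_{r=0}^{s-1}\gamma_{\ln X^2}(sh+r)\sim\begin{cases}C_1\,\mathscr C_2(h)\,h^{d-1}, & \text{if } d<0,\ d\notin\mathbb Z \text{ and } C_1\neq0,\\[2pt] \mathscr C_1(h)\,h^{2d-1}, & \text{if } d>0.\end{cases}$$ -/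

import Mathlib

open MeasureTheory ProbabilityTheory

namespace SFIEGARCH

noncomputable section

/-- The `j`-th Maclaurin coefficient of `(1 - x)^(-d)`, that is `d (d+1) ⋯ (d+j-1) / j!`. -/
def deltaCoeff (d : ℝ) (j : ℕ) : ℝ :=
  (ascPochhammer ℝ j).eval d / (j.factorial : ℝ)

/-- Off the poles of the Gamma function, `deltaCoeff d j = Γ(j+d) / (Γ(j+1) Γ(d))`. -/
theorem deltaCoeff_eq_Gamma (d : ℝ) (hd : ∀ n : ℕ, d ≠ -(n : ℝ)) (j : ℕ) :
    deltaCoeff d j = Real.Gamma (j + d) / (Real.Gamma (j + 1) * Real.Gamma d) := by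
  have key : ∀ j : ℕ, Real.Gamma (j + d) = (ascPochhammer ℝ j).eval d * Real.Gamma d := by
    intro j
    induction j with
    | zero => simp
    | succ j ih =>
      have hne : (j : ℝ) + d ≠ 0 := fun h => hd j (by linarith)
      have h1 : ((j + 1 : ℕ) : ℝ) + d = ((j : ℝ) + d) + 1 := by push_cast; ring
      rw [h1, Real.Gamma_add_one hne, ih, ascPochhammer_succ_eval]
      ring
  have hG : Real.Gamma d ≠ 0 := Real.Gamma_ne_zero hd
  rw [key j, Real.Gamma_nat_eq_factorial, deltaCoeff, mul_div_mul_right _ _ hG]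

/-- `π_{d,k}`: the `k`-th Maclaurin coefficient of `(1 - z^s)^(-d)`. -/
def piCoeff (s : ℕ) (d : ℝ) (k : ℕ) : ℝ :=
  if s ∣ k then deltaCoeff d (k / s) else 0

/-- The power series of `f(z) = α(z) / β(z)` at the origin (`β(0) = 1` in all uses). -/
def fSeries (α β : Polynomial ℝ) : PowerSeries ℝ :=
  (α : PowerSeries ℝ) * (β : PowerSeries ℝ)⁻¹

/-- `f_k`: the coefficients of `α(z) / β(z)`. -/
def fCoeff (α β : Polynomial ℝ) (k : ℕ) : ℝ :=
  PowerSeries.coeff k (fSeries α β)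

/-- `λ_{d,k}`: the coefficients of `λ(z) = (α(z) / β(z)) (1 - z^s)^(-d)`. -/
def lamCoeff (α β : Polynomial ℝ) (s : ℕ) (d : ℝ) (k : ℕ) : ℝ :=
  PowerSeries.coeff k (fSeries α β * PowerSeries.mk (piCoeff s d))

variable {Ω : Type*} [MeasurableSpace Ω]

/-- `g(Z_t) = θ Z_t + γ (|Z_t| - E|Z_t|)`. -/
def gInnov (P : Measure Ω) (θ γ : ℝ) (Z : ℤ → Ω → ℝ) (t : ℤ) (x : Ω) : ℝ :=
  θ * Z t x + γ * (|Z t x| - ∫ y, |Z t y| ∂P)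

/-- `X` is an SFIEGARCH`(p,d,q)_s` process with volatility `σ` and innovations `Z`; the orders `p`
and `q` are the degrees of the polynomials `α` and `β`. -/
structure IsSFIEGARCH (P : Measure Ω) (α β : Polynomial ℝ) (s : ℕ) (d ω θ γ : ℝ)
    (Z σ X : ℤ → Ω → ℝ) : Prop where
  s_pos : 0 < s
  alpha_zero : α.coeff 0 = 1
  beta_zero : β.coeff 0 = 1
  no_common_root : ∀ z : ℂ, ¬ (Polynomial.aeval z α = 0 ∧ Polynomial.aeval z β = 0)
  beta_ne_zero : ∀ z : ℂ, ‖z‖ ≤ 1 → Polynomial.aeval z β ≠ 0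
  measurable_Z : ∀ t, Measurable (Z t)
  indep_Z : iIndepFun Z P
  identDistrib_Z : ∀ t, IdentDistrib (Z t) (Z 0) P P
  memLp_Z : MemLp (Z 0) 2 P
  mean_Z : ∫ x, Z 0 x ∂P = 0
  variance_Z : Var[Z 0; P] = 1
  sigma_pos : ∀ t, ∀ᵐ x ∂P, 0 < σ t x
  /- `ln σ_t² = ω + ∑_{k ≥ 0} λ_{d,k} g(Z_{t-1-k})`, the series converging almost surely -/
  log_sigma_sq : ∀ t, ∀ᵐ x ∂P,
    Filter.Tendsto
      (fun n : ℕ => ω + ∑ k ∈ Finset.range n,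
        lamCoeff α β s d k * gInnov P θ γ Z (t - 1 - (k : ℤ)) x)
      Filter.atTop (nhds (Real.log (σ t x ^ 2)))
  X_eq : ∀ t, ∀ᵐ x ∂P, X t x = σ t x * Z t x

/-- `Cov(Y_t, Y_{t+h})`. -/
def autocov (P : Measure Ω) (Y : ℤ → Ω → ℝ) (t h : ℤ) : ℝ :=
  cov[Y t, Y (t + h); P]

/-- The process `ln X_t²`. -/
def logSq (X : ℤ → Ω → ℝ) (t : ℤ) (x : Ω) : ℝ := Real.log (X t x ^ 2)

/-- `σ_g² = θ² + γ² - (γ E|Z_0|)² + 2 θ γ E(Z_0 |Z_0|)`. -/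
def sigmaGSq (P : Measure Ω) (θ γ : ℝ) (Z : ℤ → Ω → ℝ) : ℝ :=
  θ ^ 2 + γ ^ 2 - (γ * ∫ x, |Z 0 x| ∂P) ^ 2 + 2 * θ * γ * ∫ x, Z 0 x * |Z 0 x| ∂P

/-- `C₁ = Cov(g(Z_0), ln Z_0²)`. -/
def covGLog (P : Measure Ω) (θ γ : ℝ) (Z : ℤ → Ω → ℝ) : ℝ :=
  cov[gInnov P θ γ Z 0, logSq Z 0; P]

/-- `γ_A(h) = ∑_{i ≥ 0} f_i f_{i+|h|}`. -/
def gammaA (α β : Polynomial ℝ) (h : ℤ) : ℝ :=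
  ∑' i : ℕ, fCoeff α β i * fCoeff α β (i + h.natAbs)

/-- `γ_V(s m) = v (-1)^m Γ(1-2d) / (Γ(1-d+m) Γ(1-d-m))`, with `v = σ_g²`, and `γ_V = 0` off the
multiples of `s`. -/
def gammaV (v : ℝ) (s : ℕ) (d : ℝ) (h : ℤ) : ℝ :=
  if (s : ℤ) ∣ h then
    v * ((-1 : ℝ) ^ (h / (s : ℤ)) * Real.Gamma (1 - 2 * d)) /
      (Real.Gamma (1 - d + ((h / (s : ℤ) : ℤ) : ℝ)) *
        Real.Gamma (1 - d - ((h / (s : ℤ) : ℤ) : ℝ)))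
  else 0

/-- `𝒦(s k + r) = ∑_{0 ≤ j ≤ ⌊√k⌋} f_{s j + r} π_{d, s k - s j} / π_{d, s k}`, where `0 ≤ r < s`. -/
def calK (α β : Polynomial ℝ) (s : ℕ) (d : ℝ) (n : ℕ) : ℝ :=
  ∑ j ∈ Finset.range (Nat.sqrt (n / s) + 1),
    fCoeff α β (s * j + n % s) * (piCoeff s d (s * (n / s) - s * j) / piCoeff s d (s * (n / s)))

/-- `𝒢(s h + r) = ∑_{|k| ≤ ⌊√h⌋} γ_A(s k + r) γ_V(s h - s k) / γ_V(s h)`, where `0 ≤ r < s`;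
here `v = σ_g²`. -/
def calG (v : ℝ) (α β : Polynomial ℝ) (s : ℕ) (d : ℝ) (n : ℕ) : ℝ :=
  ∑ k ∈ Finset.Icc (-(Nat.sqrt (n / s) : ℤ)) (Nat.sqrt (n / s) : ℤ),
    gammaA α β ((s : ℤ) * k + ((n % s : ℕ) : ℤ)) *
      (gammaV v s d ((s : ℤ) * ((n / s : ℕ) : ℤ) - (s : ℤ) * k) /
        gammaV v s d ((s : ℤ) * ((n / s : ℕ) : ℤ)))

/-- `𝒞₁(h) = σ_g² Γ(1-2d) / (Γ(1-d) Γ(d)) ∑_{r < s} 𝒢(s h + r)`, with `v = σ_g²`. -/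
def calC1 (v : ℝ) (α β : Polynomial ℝ) (s : ℕ) (d : ℝ) (h : ℕ) : ℝ :=
  v * (Real.Gamma (1 - 2 * d) / (Real.Gamma (1 - d) * Real.Gamma d)) *
    ∑ r ∈ Finset.range s, calG v α β s d (s * h + r)

/-- `𝒞₂(h) = Γ(d)⁻¹ ∑_{r < s} 𝒦(s h + r - 1)`, for `h ≥ 1`. -/
def calC2 (α β : Polynomial ℝ) (s : ℕ) (d : ℝ) (h : ℕ) : ℝ :=
  (1 / Real.Gamma d) * ∑ r ∈ Finset.range s, calK α β s d (s * h + r - 1)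

end

end SFIEGARCH

namespace SFIEGARCH

open Filter Topology Finset

/-! Since `ln X_t² = ln σ_t² + ln Z_t²` and `ln σ_t²` is a series in the strict past of `Z`, the
autocovariance at a lag `n > 0` is `σ_g² ∑_k λ_k λ_{k+n} + C₁ λ_{n-1}` (`autocov_logSq_X`). The
square-summability of `λ` makes the volatility series converge in L², which justifies computing
covariances term by term (`memLp_of_tendsto_orthogonal_series`).

The rest is asymptotics of `λ`. On a residue class modulo `s`, `λ` is the convolution of `δ_m ~
m^(d-1)/Γ(d)` with a geometrically decaying part of `f`, so it inherits the rate `m^(d-1)`, with the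
constant `∑_i f_{si+q} / Γ(d)`. This constant may vanish for some `q`. A block of `s` consecutive
indices meets every class once, so its constant is `f(1)/Γ(d)` with `f(1) = ∑ f_k ≠ 0`; this is why
the theorem concerns block sums.

For `d > 0` the correlation sum is a Riemann sum for a Beta integral (`HasRate.corr`), of order
`h^(2d-1)`, and it dominates the cross term of order `h^(d-1)`. For `d < 0` the sequence `λ` is
absolutely summable with sum zero on each class, so the correlation sum is `o(h^(d-1))` and the
cross term decides.

The factors `calC1` and `calC2` converge to the constants found this way (`tendsto_calC1`,
`tendsto_calC2`): their truncated sums tend to `∑ γ_A = f(1)²` and to `f(1)`. When these limits are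
nonzero, `HasRate.isEquivalent` concludes. -/

/-- `a n` is asymptotic to `L * n ^ (-e)` (or of smaller order, if `L = 0`). -/
def HasRate (a : ℕ → ℝ) (e L : ℝ) : Prop :=
  Tendsto (fun n : ℕ => a n * ((n : ℝ) + 1) ^ e) atTop (𝓝 L)

/-! ### Calculus of power rates -/

theorem tendsto_add_const_div_add_one (c : ℝ) :
    Tendsto (fun n : ℕ => ((n : ℝ) + 1 + c) / ((n : ℝ) + 1)) atTop (𝓝 1) := by
  have h : Tendsto (fun n : ℕ => 1 + c * (1 / ((n : ℝ) + 1))) atTop (𝓝 (1 + c * 0)) :=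
    (tendsto_one_div_add_atTop_nhds_zero_nat.const_mul c).const_add 1
  simp only [mul_zero, add_zero] at h
  refine h.congr fun n => ?_
  have : (n : ℝ) + 1 ≠ 0 := by positivity
  field_simp

theorem tendsto_rpow_ratio (c e : ℝ) :
    Tendsto (fun n : ℕ => (((n : ℝ) + 1 + c) / ((n : ℝ) + 1)) ^ e) atTop (𝓝 1) := by
  simpa using (tendsto_add_const_div_add_one c).rpow_const (p := e) (Or.inl one_ne_zero)

namespace HasRate

variable {a b : ℕ → ℝ} {e A B : ℝ}

theorem congr' (ha : HasRate a e A) (h : ∀ᶠ n in atTop, a n = b n) : HasRate b e A :=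
  Tendsto.congr' (h.mono fun n hn => by simp only [hn]) ha

theorem add (ha : HasRate a e A) (hb : HasRate b e B) :
    HasRate (fun n => a n + b n) e (A + B) :=
  (Tendsto.add ha hb).congr fun n => by ring

theorem const_mul (ha : HasRate a e A) (c : ℝ) : HasRate (fun n => c * a n) e (c * A) :=
  (Tendsto.const_mul c ha).congr fun n => by ring

theorem zero (e : ℝ) : HasRate (fun _ => 0) e 0 := by simp [HasRate]

theorem sum {ι : Type*} {x : ι → ℕ → ℝ} {L : ι → ℝ} (S : Finset ι)
    (h : ∀ i ∈ S, HasRate (x i) e (L i)) :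
    HasRate (fun n => ∑ i ∈ S, x i n) e (∑ i ∈ S, L i) :=
  (tendsto_finsetSum S h).congr fun n => by rw [Finset.sum_mul]

/-- A convergent sequence is bounded. The weight `n + 1` instead of `n` makes the bound valid at `n
= 0` too, as dominated convergence requires. -/
theorem exists_bound (ha : HasRate a e A) :
    ∃ C, 0 ≤ C ∧ ∀ n : ℕ, |a n| ≤ C * ((n : ℝ) + 1) ^ (-e) := by
  obtain ⟨C, hC⟩ := (Metric.isBounded_range_of_tendsto _ ha).exists_norm_le
  refine ⟨C, (norm_nonneg _).trans (hC _ ⟨0, rfl⟩), fun n => ?_⟩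
  have hp : (0 : ℝ) < (n : ℝ) + 1 := by positivity
  have h := hC _ ⟨n, rfl⟩
  rw [norm_mul, Real.norm_eq_abs, Real.norm_of_nonneg (by positivity)] at h
  rw [Real.rpow_neg hp.le, ← div_eq_mul_inv, le_div_iff₀ (by positivity)]
  exact h

/-- The normalisation may be taken at a shifted index. -/
theorem tendsto_shift (ha : HasRate a e A) (k : ℕ) :
    Tendsto (fun n : ℕ => a n * (((n + k : ℕ) : ℝ) + 1) ^ e) atTop (𝓝 A) := by
  have h := Tendsto.mul ha (tendsto_rpow_ratio k e)
  rw [mul_one] at h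
  refine h.congr fun n => ?_
  rw [Real.div_rpow (by positivity) (by positivity), mul_assoc, mul_div_cancel₀ _ (by positivity)]
  push_cast
  ring_nf

theorem tendsto_sub (ha : HasRate a e A) (k : ℕ) :
    Tendsto (fun n : ℕ => a (n - k) * ((n : ℝ) + 1) ^ e) atTop (𝓝 A) := by
  rw [← tendsto_add_atTop_iff_nat k]
  simpa using ha.tendsto_shift k

theorem shift (ha : HasRate a e A) (k : ℕ) : HasRate (fun n => a (n + k)) e A := by
  have h : Tendsto (fun n : ℕ => a (n + k) * (((n + k : ℕ) : ℝ) + 1) ^ e) atTop (𝓝 A) :=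
    (tendsto_add_atTop_iff_nat k).2 ha
  have h2 := Tendsto.mul h (tendsto_rpow_ratio k (-e))
  rw [mul_one] at h2
  refine h2.congr fun n => ?_
  have h1 : ((n + k : ℕ) : ℝ) + 1 = (n : ℝ) + 1 + k := by push_cast; ring
  rw [h1, Real.div_rpow (by positivity) (by positivity), Real.rpow_neg (by positivity),
    Real.rpow_neg (by positivity)]
  have h3 : ((n : ℝ) + 1 + k) ^ e ≠ 0 := by positivity
  have h4 : ((n : ℝ) + 1) ^ e ≠ 0 := by positivity
  field_simp

/-- A larger exponent forces smaller rates to vanish. -/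
theorem of_lt {e' : ℝ} (ha : HasRate a e A) (h : e' < e) : HasRate a e' 0 := by
  have h0 : Tendsto (fun n : ℕ => ((n : ℝ) + 1) ^ (-(e - e'))) atTop (𝓝 0) :=
    (tendsto_rpow_neg_atTop (sub_pos.2 h)).comp
      (tendsto_atTop_add_const_right _ _ tendsto_natCast_atTop_atTop)
  have h2 := Tendsto.mul ha h0
  rw [mul_zero] at h2
  refine h2.congr fun n => ?_
  rw [mul_assoc, ← Real.rpow_add (by positivity)]
  ring_nf

theorem summable_mul (ha : HasRate a e A) (hb : HasRate b e B) (he : 1 / 2 < e) (h : ℕ) :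
    Summable fun i => a i * b (i + h) := by
  obtain ⟨C, hC0, hC⟩ := ha.exists_bound
  obtain ⟨D, hD0, hD⟩ := (hb.shift h).exists_bound
  have hs : Summable fun n : ℕ => (((n + 1 : ℕ) : ℝ)) ^ (-(2 * e)) :=
    (summable_nat_add_iff 1).2 (Real.summable_nat_rpow.2 (by linarith))
  refine Summable.of_norm_bounded (hs.mul_left (C * D)) fun i => ?_
  rw [norm_mul, Real.norm_eq_abs, Real.norm_eq_abs]
  refine (mul_le_mul (hC i) (hD i) (abs_nonneg _) (by positivity)).trans (le_of_eq ?_)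
  have : -(2 * e) = -e + -e := by ring
  rw [this, Real.rpow_add (by positivity)]
  push_cast
  ring

theorem summable_abs (ha : HasRate a e A) (he : 1 < e) : Summable fun i => |a i| := by
  obtain ⟨C, hC0, hC⟩ := ha.exists_bound
  have hs : Summable fun n : ℕ => (((n + 1 : ℕ) : ℝ)) ^ (-e) :=
    (summable_nat_add_iff 1).2 (Real.summable_nat_rpow.2 (by linarith))
  refine Summable.of_nonneg_of_le (fun _ => abs_nonneg _) (fun i => ?_) (hs.mul_left C)
  exact_mod_cast hC i

/-- Truncated convolution with a sequence that decays faster keeps the rate. -/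
theorem conv {u : ℕ → ℝ} (he : 0 ≤ e) (hu : Summable fun i : ℕ => |u i| * ((i : ℝ) + 1) ^ e)
    (ha : HasRate a e A) {N : ℕ → ℕ} (hN : ∀ n, N n ≤ n) (hN' : Tendsto N atTop atTop) :
    -- The truncated sum is a series extended by zero, so dominated convergence applies; the
    -- dominating terms are `C |u i| (i+1)^e`.
    HasRate (fun n => ∑ i ∈ range (N n + 1), u i * a (n - i)) e (A * ∑' i, u i) := by
  obtain ⟨C, hC0, hC⟩ := ha.exists_bound
  have key := tendsto_tsum_of_dominated_convergence
    (f := fun n i => if i ∈ range (N n + 1) then u i * (a (n - i) * ((n : ℝ) + 1) ^ e) else 0)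
    (g := fun i => u i * A) (𝓕 := atTop) (hu.mul_left C) ?_ ?_
  · rw [tsum_mul_right, mul_comm] at key
    refine key.congr fun n => ?_
    rw [tsum_eq_sum (s := range (N n + 1)) fun i hi => if_neg hi, Finset.sum_mul]
    exact Finset.sum_congr rfl fun i hi => by rw [if_pos hi, mul_assoc]
  · intro i
    refine ((ha.tendsto_sub i).const_mul (u i)).congr' ?_
    filter_upwards [hN'.eventually_ge_atTop i] with n hn
    rw [if_pos (mem_range.2 (by omega))]
  · refine Eventually.of_forall fun n i => ?_
    split_ifs with hi
    · have hin : i ≤ n := by have := hN n; have := mem_range.1 hi; omega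
      have h1 := hC (n - i)
      -- The inequality `n + 1 ≤ (n - i + 1)(i + 1)` moves the weight from `n` onto `a (n - i)` and
      -- `u i`.
      have hle : ((n : ℝ) + 1) ^ e ≤ (((n - i : ℕ) : ℝ) + 1) ^ e * ((i : ℝ) + 1) ^ e := by
        rw [← Real.mul_rpow (by positivity) (by positivity)]
        refine Real.rpow_le_rpow (by positivity) ?_ he
        have : (n : ℝ) = ((n - i : ℕ) : ℝ) + i := by exact_mod_cast (Nat.sub_add_cancel hin).symm
        rw [this]
        nlinarith [Nat.cast_nonneg (α := ℝ) (n - i), Nat.cast_nonneg (α := ℝ) i]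
      rw [norm_mul, norm_mul, Real.norm_eq_abs, Real.norm_eq_abs,
        Real.norm_of_nonneg (by positivity)]
      have h2 : |a (n - i)| * ((n : ℝ) + 1) ^ e ≤ C * ((i : ℝ) + 1) ^ e := by
        calc _ ≤ (C * (((n - i : ℕ) : ℝ) + 1) ^ (-e)) *
              ((((n - i : ℕ) : ℝ) + 1) ^ e * ((i : ℝ) + 1) ^ e) := by gcongr
          _ = C * ((((n - i : ℕ) : ℝ) + 1) ^ (-e + e)) * ((i : ℝ) + 1) ^ e := by
            rw [Real.rpow_add (by positivity)]; ring
          _ = _ := by simp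
      calc _ ≤ |u i| * (C * ((i : ℝ) + 1) ^ e) := by gcongr
        _ = _ := by ring
    · rw [norm_zero]; positivity

/-- Correlating with a summable sequence. -/
theorem corr_of_summable (he : 0 ≤ e) (ha : Summable fun i => |a i|) (hb : HasRate b e B) :
    HasRate (fun h => ∑' i, a i * b (i + h)) e ((∑' i, a i) * B) := by
  obtain ⟨C, hC0, hC⟩ := hb.exists_bound
  have key := tendsto_tsum_of_dominated_convergence
    (f := fun (h : ℕ) i => a i * (b (i + h) * ((h : ℝ) + 1) ^ e))
    (g := fun i => a i * B) (𝓕 := atTop) (ha.mul_left C) ?_ ?_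
  · rw [tsum_mul_right] at key
    refine key.congr fun n => ?_
    rw [← tsum_mul_right]
    simp only [mul_assoc]
  · intro i
    have := (hb.shift i).const_mul (a i)
    refine Tendsto.congr (fun n => ?_) this
    simp only [add_comm n i, mul_assoc]
  · refine Eventually.of_forall fun n i => ?_
    rw [norm_mul, norm_mul, Real.norm_eq_abs, Real.norm_eq_abs,
      Real.norm_of_nonneg (by positivity : (0 : ℝ) ≤ ((n : ℝ) + 1) ^ e)]
    have h2 : |b (i + n)| * ((n : ℝ) + 1) ^ e ≤ C := by
      calc _ ≤ C * (((i + n : ℕ) : ℝ) + 1) ^ (-e) * (((i + n : ℕ) : ℝ) + 1) ^ e := by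
            gcongr
            · exact hC _
            · omega
        _ = _ := by rw [mul_assoc, ← Real.rpow_add (by positivity)]; simp
    calc _ ≤ |a i| * C := by gcongr
      _ = _ := by ring

end HasRate

/-! ### Coefficients of `(1 - x)^(-d)` -/

/-- `δ_n ~ n^(d-1) / Γ(d)`; the limit is `0` at the poles of `Γ`, where `Γ(d)⁻¹` is `0`. -/
theorem hasRate_deltaCoeff (d : ℝ) : HasRate (deltaCoeff d) (1 - d) (Real.Gamma d)⁻¹ := by
  have hprod : ∀ n : ℕ, (ascPochhammer ℝ n).eval d = ∏ j ∈ range n, (d + j) := by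
    intro n
    induction n with
    | zero => simp
    | succ n ih => rw [ascPochhammer_succ_eval, Finset.prod_range_succ, ih]
  by_cases hd : Real.Gamma d = 0
  · obtain ⟨m, hm⟩ := (Real.Gamma_eq_zero_iff d).1 hd
    rw [hd, inv_zero]
    refine (HasRate.zero _).congr' ?_
    filter_upwards [eventually_gt_atTop m] with n hn
    rw [deltaCoeff, hprod, Finset.prod_eq_zero (mem_range.2 hn) (by rw [hm]; ring), zero_div]
  -- The reciprocal of Euler's sequence is `(n+1) n^(-d) δ_{n+1}`; the two ratio factors turn its
  -- weight into `(n+2)^(1-d)`, the one for index `n + 1`.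
  · have h1 : Tendsto (fun n : ℕ => (Real.GammaSeq d n)⁻¹) atTop (𝓝 (Real.Gamma d)⁻¹) :=
      (Real.GammaSeq_tendsto_Gamma d).inv₀ hd
    have h2 := (h1.mul (tendsto_rpow_ratio (-1) d)).mul (tendsto_rpow_ratio 1 (1 - d))
    rw [mul_one, mul_one] at h2
    rw [HasRate, ← tendsto_add_atTop_iff_nat 1]
    refine h2.congr' ?_
    filter_upwards [eventually_gt_atTop 0] with n hn
    have hn' : (0 : ℝ) < n := by exact_mod_cast hn
    rw [Real.GammaSeq, deltaCoeff, hprod, Nat.factorial_succ,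
      Real.div_rpow (by linarith) (by positivity), Real.div_rpow (by positivity) (by positivity)]
    have e1 : (n : ℝ) + 1 + -1 = n := by ring
    have e2 : ((n + 1 : ℕ) : ℝ) + 1 = (n : ℝ) + 1 + 1 := by push_cast; ring
    have e3 : ((n : ℝ) + 1) ^ (1 - d) = ((n : ℝ) + 1) / ((n : ℝ) + 1) ^ d := by
      rw [Real.rpow_sub (by positivity), Real.rpow_one]
    rw [e1, e2, e3]
    have : (n : ℝ) ^ d ≠ 0 := by positivity
    have : ((n : ℝ) + 1) ^ d ≠ 0 := by positivity
    have : (n.factorial : ℝ) ≠ 0 := by positivity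
    push_cast
    field_simp

/-! ### Beta integrals and long memory correlations -/

/-- A summable series as the integral of a step function. -/
theorem integral_floor_eq_tsum {c : ℕ → ℝ} (hc : Summable fun i => |c i|) :
    ∫ y in Set.Ioi (0 : ℝ), c ⌊y⌋₊ = ∑' i, c i := by
  have hU : (⋃ n : ℕ, Set.Ico (n : ℝ) (n + 1)) = Set.Ici 0 := by
    ext y
    simp only [Set.mem_iUnion, Set.mem_Ico, Set.mem_Ici]
    constructor
    · rintro ⟨n, h1, -⟩
      exact (Nat.cast_nonneg n).trans h1
    · intro h
      exact ⟨⌊y⌋₊, Nat.floor_le h, Nat.lt_floor_add_one y⟩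
  have hdisj : Pairwise (Function.onFun Disjoint fun n : ℕ => Set.Ico (n : ℝ) (n + 1)) := by
    intro m n hmn
    rw [Function.onFun, Set.disjoint_left]
    rintro y ⟨h1, h2⟩ ⟨h3, h4⟩
    have h0 : (0 : ℝ) ≤ y := (Nat.cast_nonneg m).trans h1
    exact hmn (((Nat.floor_eq_iff h0).2 ⟨h1, h2⟩).symm.trans ((Nat.floor_eq_iff h0).2 ⟨h3, h4⟩))
  have hfl : ∀ n : ℕ, ∀ y ∈ Set.Ico (n : ℝ) (n + 1), ⌊y⌋₊ = n := fun n y hy =>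
    (Nat.floor_eq_iff ((Nat.cast_nonneg n).trans hy.1)).2 hy
  have hint : ∀ (g : ℝ → ℝ) (n : ℕ),
      ∫ y in Set.Ico (n : ℝ) (n + 1), g (c ⌊y⌋₊) = g (c n) := by
    intro g n
    rw [setIntegral_congr_fun (g := fun _ => g (c n)) measurableSet_Ico
      fun y hy => by simp only [hfl n y hy]]
    simp
  have hi : IntegrableOn (fun y : ℝ => c ⌊y⌋₊) (⋃ n : ℕ, Set.Ico (n : ℝ) (n + 1)) := by
    refine integrableOn_iUnion_of_summable_integral_norm (fun n => ?_) ?_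
    · refine (integrableOn_const (C := c n) (by simp)).congr_fun
        (fun y hy => by simp only [hfl n y hy]) measurableSet_Ico
    · simpa only [hint, Real.norm_eq_abs] using hc
  rw [← integral_Ici_eq_integral_Ioi, ← hU,
    integral_iUnion (fun _ => measurableSet_Ico) hdisj hi]
  exact tsum_congr fun n => hint id n

/-- The substitution `x = u / (1 - u)` carries Euler's Beta integral on `(0, 1)` to the form on `(0,
∞)` that arises as the limit of the correlation sums. -/
theorem image_div_one_sub_Ioo : (fun u : ℝ => u / (1 - u)) '' Set.Ioo 0 1 = Set.Ioi 0 := by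
  ext x
  simp only [Set.mem_image, Set.mem_Ioo, Set.mem_Ioi]
  constructor
  · rintro ⟨u, ⟨h0, h1⟩, rfl⟩
    exact div_pos h0 (by linarith)
  · intro hx
    refine ⟨x / (1 + x), ⟨by positivity, (div_lt_one (by positivity)).2 (by linarith)⟩, ?_⟩
    field_simp
    ring

theorem injOn_div_one_sub : Set.InjOn (fun u : ℝ => u / (1 - u)) (Set.Ioo 0 1) := by
  rintro u ⟨-, hu⟩ v ⟨-, hv⟩ h
  rw [div_eq_div_iff (by linarith) (by linarith)] at h
  linarith

theorem hasDerivWithinAt_div_one_sub {u : ℝ} (hu : u ∈ Set.Ioo (0 : ℝ) 1) :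
    HasDerivWithinAt (fun u : ℝ => u / (1 - u)) (1 / (1 - u) ^ 2) (Set.Ioo 0 1) u := by
  have h1 : (1 : ℝ) - u ≠ 0 := by linarith [hu.2]
  have := ((hasDerivAt_id u).div ((hasDerivAt_id u).const_sub 1) h1).hasDerivWithinAt
    (s := Set.Ioo 0 1)
  exact this.congr_deriv (by simp)

theorem abs_deriv_smul_beta {p q u : ℝ} (hu : u ∈ Set.Ioo (0 : ℝ) 1) :
    |1 / (1 - u) ^ 2| • ((u / (1 - u)) ^ (p - 1) * (1 + u / (1 - u)) ^ (-(p + q))) =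
      u ^ (p - 1) * (1 - u) ^ (q - 1) := by
  have h0 := hu.1
  have h1 : (0 : ℝ) < 1 - u := by linarith [hu.2]
  have e1 : 1 + u / (1 - u) = (1 - u)⁻¹ := by field_simp; ring
  have e2 : 1 / (1 - u) ^ 2 = (1 - u) ^ (-2 : ℝ) := by
    rw [Real.rpow_neg h1.le]; norm_num
  rw [abs_of_nonneg (by positivity), e1, e2, smul_eq_mul, Real.div_rpow h0.le h1.le,
    Real.inv_rpow h1.le, Real.rpow_neg h1.le (p + q), inv_inv, div_eq_mul_inv,
    ← Real.rpow_neg h1.le]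
  calc _ = u ^ (p - 1) *
        ((1 - u) ^ (-2 : ℝ) * (1 - u) ^ (-(p - 1)) * (1 - u) ^ (p + q)) := by ring
    _ = _ := by
      rw [← Real.rpow_add h1, ← Real.rpow_add h1]
      ring_nf

theorem integrableOn_beta {p q : ℝ} (hp : 0 < p) (hq : 0 < q) :
    IntegrableOn (fun u : ℝ => u ^ (p - 1) * (1 - u) ^ (q - 1)) (Set.Ioo 0 1) := by
  have h := Complex.betaIntegral_convergent (u := p) (v := q) (by simpa) (by simpa)
  rw [intervalIntegrable_iff_integrableOn_Ioo_of_le zero_le_one] at h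
  have h2 : IntegrableOn _ _ _ := h.re
  refine h2.congr_fun (fun u hu => ?_) measurableSet_Ioo
  have h1 : (0 : ℝ) ≤ 1 - u := by linarith [hu.2]
  have e : (u : ℂ) ^ ((p : ℂ) - 1) * (1 - (u : ℂ)) ^ ((q : ℂ) - 1) =
      ((u ^ (p - 1) * (1 - u) ^ (q - 1) : ℝ) : ℂ) := by
    rw [Complex.ofReal_mul, Complex.ofReal_cpow hu.1.le, Complex.ofReal_cpow h1]
    push_cast
    rfl
  simp only [e]
  simp

theorem integral_beta {p q : ℝ} (hp : 0 < p) (hq : 0 < q) :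
    ∫ u in Set.Ioo (0 : ℝ) 1, u ^ (p - 1) * (1 - u) ^ (q - 1) =
      Real.Gamma p * Real.Gamma q / Real.Gamma (p + q) := by
  have h := beta_eq_betaIntegralReal p q hp hq
  rw [beta] at h
  rw [h, Complex.betaIntegral, intervalIntegral.integral_of_le zero_le_one,
    ← integral_Ioc_eq_integral_Ioo]
  have e : ∀ u ∈ Set.Ioc (0 : ℝ) 1, (u : ℂ) ^ ((p : ℂ) - 1) * (1 - (u : ℂ)) ^ ((q : ℂ) - 1) =
      ((u ^ (p - 1) * (1 - u) ^ (q - 1) : ℝ) : ℂ) := by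
    intro u hu
    have h1 : (0 : ℝ) ≤ 1 - u := by linarith [hu.2]
    rw [Complex.ofReal_mul, Complex.ofReal_cpow hu.1.le, Complex.ofReal_cpow h1]
    push_cast
    rfl
  rw [setIntegral_congr_fun measurableSet_Ioc e, integral_complex_ofReal, Complex.ofReal_re]

theorem integrableOn_beta_Ioi {p q : ℝ} (hp : 0 < p) (hq : 0 < q) :
    IntegrableOn (fun x : ℝ => x ^ (p - 1) * (1 + x) ^ (-(p + q))) (Set.Ioi 0) := by
  rw [← image_div_one_sub_Ioo, integrableOn_image_iff_integrableOn_abs_deriv_smul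
    measurableSet_Ioo (fun u hu => hasDerivWithinAt_div_one_sub hu) injOn_div_one_sub]
  exact (integrableOn_beta hp hq).congr_fun (fun u hu => (abs_deriv_smul_beta hu).symm)
    measurableSet_Ioo

/-- Euler's second integral for the Beta function. -/
theorem integral_beta_Ioi {p q : ℝ} (hp : 0 < p) (hq : 0 < q) :
    ∫ x in Set.Ioi (0 : ℝ), x ^ (p - 1) * (1 + x) ^ (-(p + q)) =
      Real.Gamma p * Real.Gamma q / Real.Gamma (p + q) := by
  rw [← image_div_one_sub_Ioo, integral_image_eq_integral_abs_deriv_smul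
    measurableSet_Ioo (fun u hu => hasDerivWithinAt_div_one_sub hu) injOn_div_one_sub,
    ← integral_beta hp hq]
  exact setIntegral_congr_fun measurableSet_Ioo fun u hu => abs_deriv_smul_beta hu

/-- Along a sequence of indices `m h` with `(m h + 1) / (h + 1) → x`, a sequence with rate `e`
behaves like `A * (x * h) ^ (-e)`. -/
theorem HasRate.tendsto_comp {a : ℕ → ℝ} {e A x : ℝ} (ha : HasRate a e A) (hx : 0 < x)
    {m : ℕ → ℕ} (hm : Tendsto (fun h : ℕ => ((m h : ℝ) + 1) / ((h : ℝ) + 1)) atTop (𝓝 x)) :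
    Tendsto (fun h : ℕ => a (m h) * ((h : ℝ) + 1) ^ e) atTop (𝓝 (A * x ^ (-e))) := by
  have h1 : Tendsto (fun h : ℕ => (h : ℝ) + 1) atTop atTop :=
    tendsto_atTop_add_const_right _ _ tendsto_natCast_atTop_atTop
  have h2 : Tendsto (fun h : ℕ => (m h : ℝ) + 1) atTop atTop := by
    refine (hm.pos_mul_atTop hx h1).congr fun h => ?_
    rw [div_mul_cancel₀ _ (by positivity)]
  have hm' : Tendsto m atTop atTop := by
    rw [← tendsto_natCast_atTop_iff (R := ℝ)]
    exact (tendsto_atTop_add_const_right _ (-1) h2).congr fun h => by ring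
  refine ((Tendsto.comp ha hm').mul (hm.rpow_const (p := -e) (Or.inl hx.ne'))).congr fun h => ?_
  simp only [Function.comp]
  rw [Real.div_rpow (by positivity) (by positivity), Real.rpow_neg (by positivity),
    Real.rpow_neg (by positivity)]
  have : ((m h : ℝ) + 1) ^ e ≠ 0 := by positivity
  field_simp

/-- Correlation of two sequences of rate `1 - d` in the long memory range. -/
theorem HasRate.corr {d : ℝ} (hd0 : 0 < d) (hd : d < 1 / 2) {a b : ℕ → ℝ} {A B : ℝ}
    (ha : HasRate a (1 - d) A) (hb : HasRate b (1 - d) B) :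
    HasRate (fun h => ∑' i, a i * b (i + h)) (1 - 2 * d)
      (A * B * (Real.Gamma d * Real.Gamma (1 - 2 * d) / Real.Gamma (1 - d))) := by
  obtain ⟨C, hC0, hC⟩ := ha.exists_bound
  obtain ⟨D, hD0, hD⟩ := hb.exists_bound
  -- The Beta parameters are `d` and `1 - 2d`: the first is positive by `0 < d` (convergence at
  -- `0`), the second by `d < 1/2` (convergence at infinity).
  have e1 : (1 : ℝ) - d = d + (1 - 2 * d) := by ring
  have hbeta := integral_beta_Ioi hd0 (by linarith : 0 < 1 - 2 * d)
  have hbint := integrableOn_beta_Ioi hd0 (by linarith : 0 < 1 - 2 * d)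
  rw [← e1] at hbeta hbint
  -- The series is the integral of a step function; after the substitution `y = (h+1) x` the
  -- integrand, weighted by `(h+1)^(1-d)` for each factor, converges pointwise.
  have key := tendsto_integral_of_dominated_convergence (μ := volume.restrict (Set.Ioi (0 : ℝ)))
    (F := fun (h : ℕ) x => (a ⌊((h : ℝ) + 1) * x⌋₊ * ((h : ℝ) + 1) ^ (1 - d)) *
      (b (⌊((h : ℝ) + 1) * x⌋₊ + h) * ((h : ℝ) + 1) ^ (1 - d)))
    (f := fun x => (A * x ^ (-(1 - d))) * (B * (1 + x) ^ (-(1 - d))))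
    (fun x => C * D * 2 ^ (1 - d) * (x ^ (d - 1) * (1 + x) ^ (-(1 - d)))) ?_
    (hbint.const_mul _) ?_ ?_
  · have hlim : ∫ x in Set.Ioi (0 : ℝ), (A * x ^ (-(1 - d))) * (B * (1 + x) ^ (-(1 - d))) =
        A * B * (Real.Gamma d * Real.Gamma (1 - 2 * d) / Real.Gamma (1 - d)) := by
      rw [← hbeta, ← integral_const_mul]
      congr 1
      ext x
      rw [neg_sub]
      ring
    rw [hlim] at key
    refine key.congr fun h => ?_
    have hH : (0 : ℝ) < (h : ℝ) + 1 := by positivity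
    have hs : Summable fun i => |a i * b (i + h)| :=
      (ha.summable_mul hb (by linarith) h).abs
    change _ = (∑' i, a i * b (i + h)) * _
    rw [← integral_floor_eq_tsum hs]
    have h2 := integral_comp_mul_left_Ioi (fun y : ℝ => a ⌊y⌋₊ * b (⌊y⌋₊ + h)) 0 hH
    rw [mul_zero, smul_eq_mul] at h2
    have h3 : ((h : ℝ) + 1) ^ (1 - 2 * d) =
        ((h : ℝ) + 1) ^ (1 - d) * ((h : ℝ) + 1) ^ (1 - d) * ((h : ℝ) + 1)⁻¹ := by
      rw [← Real.rpow_neg_one, ← Real.rpow_add hH, ← Real.rpow_add hH]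
      ring_nf
    rw [h3, mul_comm, mul_assoc, ← h2, ← integral_const_mul]
    congr 1
    ext x
    ring
  · intro h
    refine Measurable.aestronglyMeasurable ?_
    have hfl : Measurable fun x : ℝ => ⌊((h : ℝ) + 1) * x⌋₊ :=
      Nat.measurable_floor.comp (measurable_id.const_mul _)
    have m1 : Measurable fun x : ℝ => a ⌊((h : ℝ) + 1) * x⌋₊ :=
      (measurable_of_countable a).comp hfl
    have m2 : Measurable fun x : ℝ => b (⌊((h : ℝ) + 1) * x⌋₊ + h) :=
      (measurable_of_countable fun n => b (n + h)).comp hfl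
    exact (m1.mul_const _).mul (m2.mul_const _)
  · intro h
    refine (ae_restrict_iff' measurableSet_Ioi).2 (Eventually.of_forall fun x hx => ?_)
    have hx : (0 : ℝ) < x := hx
    have hH : (0 : ℝ) < (h : ℝ) + 1 := by positivity
    set m := ⌊((h : ℝ) + 1) * x⌋₊ with hm
    have hm1 : ((h : ℝ) + 1) * x ≤ (m : ℝ) + 1 := (Nat.lt_floor_add_one _).le
    have hp : -(1 - d) ≤ 0 := by linarith
    have b1 : |a m| * ((h : ℝ) + 1) ^ (1 - d) ≤ C * x ^ (d - 1) := by
      calc _ ≤ C * (((h : ℝ) + 1) * x) ^ (-(1 - d)) * ((h : ℝ) + 1) ^ (1 - d) := by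
            gcongr
            exact (hC m).trans (mul_le_mul_of_nonneg_left
              (Real.rpow_le_rpow_of_nonpos (by positivity) hm1 hp) hC0)
        _ = C * x ^ (d - 1) * (((h : ℝ) + 1) ^ (-(1 - d)) * ((h : ℝ) + 1) ^ (1 - d)) := by
            rw [Real.mul_rpow hH.le hx.le, neg_sub]; ring
        _ = _ := by rw [← Real.rpow_add hH]; simp
    have b2 : |b (m + h)| * ((h : ℝ) + 1) ^ (1 - d) ≤
        D * 2 ^ (1 - d) * (1 + x) ^ (-(1 - d)) := by
      -- The factor `1/2` absorbs the loss of at most one from the floor, and is the source of `2 ^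
      -- (1 - d)` in the dominating function.
      have hle : ((h : ℝ) + 1) * ((1 + x) / 2) ≤ ((m + h : ℕ) : ℝ) + 1 := by
        push_cast
        nlinarith [Nat.cast_nonneg (α := ℝ) h, Nat.cast_nonneg (α := ℝ) m]
      calc _ ≤ D * (((h : ℝ) + 1) * ((1 + x) / 2)) ^ (-(1 - d)) * ((h : ℝ) + 1) ^ (1 - d) := by
            gcongr
            exact (hD _).trans (mul_le_mul_of_nonneg_left
              (Real.rpow_le_rpow_of_nonpos (by positivity) hle hp) hD0)
        _ = D * 2 ^ (1 - d) * (1 + x) ^ (-(1 - d)) *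
              (((h : ℝ) + 1) ^ (-(1 - d)) * ((h : ℝ) + 1) ^ (1 - d)) := by
            rw [Real.mul_rpow hH.le (by positivity), Real.div_rpow (by positivity) (by norm_num),
              Real.rpow_neg (by norm_num : (0 : ℝ) ≤ 2), div_inv_eq_mul]
            ring
        _ = _ := by rw [← Real.rpow_add hH]; simp
    simp only [norm_mul, Real.norm_eq_abs]
    rw [abs_of_nonneg (by positivity : (0 : ℝ) ≤ ((h : ℝ) + 1) ^ (1 - d))]
    calc _ ≤ (C * x ^ (d - 1)) * (D * 2 ^ (1 - d) * (1 + x) ^ (-(1 - d))) := by gcongr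
      _ = _ := by ring
  · refine (ae_restrict_iff' measurableSet_Ioi).2 (Eventually.of_forall fun x hx => ?_)
    have hx : (0 : ℝ) < x := hx
    have hfl : Tendsto (fun h : ℕ => ((⌊((h : ℝ) + 1) * x⌋₊ : ℝ)) / ((h : ℝ) + 1)) atTop
        (𝓝 x) := by
      have h1 : Tendsto (fun h : ℕ => (h : ℝ) + 1) atTop atTop :=
        tendsto_atTop_add_const_right _ _ tendsto_natCast_atTop_atTop
      refine ((tendsto_nat_floor_mul_div_atTop hx.le).comp h1).congr fun h => ?_
      simp only [Function.comp, mul_comm x]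
    have h0 : Tendsto (fun h : ℕ => 1 / ((h : ℝ) + 1)) atTop (𝓝 0) :=
      tendsto_one_div_add_atTop_nhds_zero_nat
    refine (ha.tendsto_comp hx ?_).mul (hb.tendsto_comp (by linarith : 0 < 1 + x) ?_)
    · have := hfl.add h0
      rw [add_zero] at this
      refine this.congr fun h => by rw [add_div]
    · have := hfl.add_const 1
      rw [add_comm x] at this
      refine this.congr fun h => ?_
      have : (h : ℝ) + 1 ≠ 0 := by positivity
      push_cast
      field_simp
      ring

/-! ### Geometric decay of the coefficients of `α / β` -/

/-- Power series that converge absolutely at radius `R` are closed under products. -/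
theorem summable_norm_coeff_mul {p q : PowerSeries ℂ} {R : ℝ}
    (hp : Summable fun n => ‖PowerSeries.coeff n p * (R : ℂ) ^ n‖)
    (hq : Summable fun n => ‖PowerSeries.coeff n q * (R : ℂ) ^ n‖) :
    Summable fun n => ‖PowerSeries.coeff n (p * q) * (R : ℂ) ^ n‖ := by
  refine (summable_norm_sum_mul_antidiagonal_of_summable_norm hp hq).congr fun n => ?_
  rw [PowerSeries.coeff_mul, Finset.sum_mul]
  congr 1
  refine Finset.sum_congr rfl fun ij hij => ?_
  rw [← HasAntidiagonal.mem_antidiagonal.1 hij, pow_add]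
  ring

theorem summable_norm_coeff_polynomial (p : Polynomial ℂ) (R : ℝ) :
    Summable fun n => ‖PowerSeries.coeff n (p : PowerSeries ℂ) * (R : ℂ) ^ n‖ := by
  refine summable_of_ne_finset_zero (s := p.support) fun n hn => ?_
  rw [Polynomial.coeff_coe, Polynomial.notMem_support_iff.1 hn, zero_mul, norm_zero]

/-- The inverse of a product of linear factors whose roots have modulus greater than `R`
converges absolutely at radius `R`. -/
theorem exists_inverse_prod_linear {R : ℝ} (hR : 0 < R) (S : Multiset ℂ)
    (hS : ∀ a ∈ S, R < ‖a‖) :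
    ∃ g : PowerSeries ℂ, (Summable fun n => ‖PowerSeries.coeff n g * (R : ℂ) ^ n‖) ∧
      g * (((S.map fun a => Polynomial.X - Polynomial.C a).prod : Polynomial ℂ) :
        PowerSeries ℂ) = 1 := by
  induction S using Multiset.induction_on with
  | empty =>
    refine ⟨1, ?_, by simp⟩
    simpa using summable_norm_coeff_polynomial 1 R
  | cons a S ih =>
    obtain ⟨g, hg, hg1⟩ := ih fun b hb => hS b (Multiset.mem_cons_of_mem hb)
    have ha : R < ‖a‖ := hS a (Multiset.mem_cons_self a S)
    have ha0 : a ≠ 0 := norm_pos_iff.1 (hR.trans ha)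
    -- The geometric expansion of `1 / (X - a)`.
    set k : PowerSeries ℂ := PowerSeries.mk fun n => -(a⁻¹ ^ (n + 1)) with hk
    have hk1 : k * ((Polynomial.X - Polynomial.C a : Polynomial ℂ) : PowerSeries ℂ) = 1 := by
      rw [Polynomial.coe_sub, Polynomial.coe_X, Polynomial.coe_C, mul_sub]
      ext n
      rw [map_sub, PowerSeries.coeff_mul_C]
      cases n with
      | zero => simp [hk, ha0]
      | succ n =>
        rw [PowerSeries.coeff_succ_mul_X, PowerSeries.coeff_one]
        simp only [hk, PowerSeries.coeff_mk]
        rw [pow_succ a⁻¹ (n + 1)]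
        simp [ha0]
    have hks : Summable fun n => ‖PowerSeries.coeff n k * (R : ℂ) ^ n‖ := by
      have hgeo : Summable fun n : ℕ => ‖a‖⁻¹ * (R / ‖a‖) ^ n :=
        (summable_geometric_of_lt_one (by positivity)
          ((div_lt_one (hR.trans ha)).2 ha)).mul_left _
      refine hgeo.congr fun n => ?_
      simp only [hk, PowerSeries.coeff_mk, norm_mul, norm_neg, norm_pow, norm_inv,
        Complex.norm_real, Real.norm_of_nonneg hR.le]
      rw [pow_succ, div_pow, div_eq_mul_inv, inv_pow]
      ring
    refine ⟨k * g, summable_norm_coeff_mul hks hg, ?_⟩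
    rw [Multiset.map_cons, Multiset.prod_cons, Polynomial.coe_mul, mul_mul_mul_comm, hk1, hg1,
      one_mul]

theorem fSeries_mul {α β : Polynomial ℝ} (hβ0 : β.coeff 0 = 1) :
    fSeries α β * (β : PowerSeries ℝ) = (α : PowerSeries ℝ) := by
  rw [fSeries, mul_assoc, PowerSeries.inv_mul_cancel, mul_one]
  rw [← PowerSeries.coeff_zero_eq_constantCoeff_apply, Polynomial.coeff_coe, hβ0]
  exact one_ne_zero

/-- The coefficients of `α / β` decay geometrically. -/
theorem exists_summable_fCoeff {α β : Polynomial ℝ} (hβ0 : β.coeff 0 = 1)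
    (hβ : ∀ z : ℂ, ‖z‖ ≤ 1 → Polynomial.aeval z β ≠ 0) :
    ∃ R : ℝ, 1 < R ∧ Summable fun n => |fCoeff α β n| * R ^ n := by
  set B : Polynomial ℂ := β.map (algebraMap ℝ ℂ) with hB
  have hβne : β ≠ 0 := by rintro rfl; simp at hβ0
  have hBne : B ≠ 0 := (Polynomial.map_ne_zero_iff (algebraMap ℝ ℂ).injective).2 hβne
  have hroots : ∀ a ∈ B.roots.toFinset, 1 < ‖a‖ := by
    intro a ha
    by_contra hle
    refine hβ a (not_lt.1 hle) ?_
    have := Polynomial.isRoot_of_mem_roots (Multiset.mem_toFinset.1 ha)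
    rwa [Polynomial.IsRoot.def, hB, Polynomial.eval_map_algebraMap] at this
  -- The roots of `β` are finitely many and lie outside the closed unit disc, so some `R > 1` is
  -- below all their moduli.
  obtain ⟨R, hR, hRa⟩ : ∃ R : ℝ, 1 < R ∧ ∀ a ∈ B.roots.toFinset, R < ‖a‖ := by
    have h1 : ∀ᶠ R : ℝ in 𝓝[>] 1, ∀ a ∈ B.roots.toFinset, R < ‖a‖ :=
      (eventually_all_finset _).2 fun a ha =>
        nhdsWithin_le_nhds (eventually_lt_nhds (hroots a ha))
    obtain ⟨R, h2, h3⟩ := (h1.and self_mem_nhdsWithin).exists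
    exact ⟨R, h3, h2⟩
  have hR0 : 0 < R := one_pos.trans hR
  obtain ⟨g, hg, hg1⟩ := exists_inverse_prod_linear hR0 B.roots
    fun a ha => hRa a (Multiset.mem_toFinset.2 ha)
  have hsplit := (IsAlgClosed.splits B).eq_prod_roots
  have hlead : B.leadingCoeff ≠ 0 := Polynomial.leadingCoeff_ne_zero.2 hBne
  have hinv : g * ((Polynomial.C B.leadingCoeff⁻¹ : Polynomial ℂ) : PowerSeries ℂ) *
      (B : PowerSeries ℂ) = 1 := by
    have hBs := congrArg (fun p : Polynomial ℂ => (p : PowerSeries ℂ)) hsplit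
    simp only [Polynomial.coe_mul] at hBs
    have hcc : ((Polynomial.C B.leadingCoeff : Polynomial ℂ) : PowerSeries ℂ) *
        ((Polynomial.C B.leadingCoeff⁻¹ : Polynomial ℂ) : PowerSeries ℂ) = 1 := by
      rw [← Polynomial.coe_mul, ← Polynomial.C_mul, mul_inv_cancel₀ hlead, Polynomial.C_1,
        Polynomial.coe_one]
    rw [hBs, mul_comm (Polynomial.toPowerSeries (Polynomial.C B.leadingCoeff)), mul_mul_mul_comm,
      hg1, one_mul, mul_comm, hcc]
  have hmapβ : PowerSeries.map (algebraMap ℝ ℂ) (β : PowerSeries ℝ) = (B : PowerSeries ℂ) := by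
    rw [hB, Polynomial.polynomial_map_coe]
  have hmap : PowerSeries.map (algebraMap ℝ ℂ) (fSeries α β) =
      ((α.map (algebraMap ℝ ℂ) : Polynomial ℂ) : PowerSeries ℂ) *
        (g * ((Polynomial.C B.leadingCoeff⁻¹ : Polynomial ℂ) : PowerSeries ℂ)) := by
    rw [Polynomial.polynomial_map_coe, ← fSeries_mul (α := α) hβ0, map_mul, hmapβ, mul_assoc,
      mul_comm (B : PowerSeries ℂ), hinv, mul_one]
  refine ⟨R, hR, ?_⟩
  have hs := summable_norm_coeff_mul (summable_norm_coeff_polynomial (α.map (algebraMap ℝ ℂ)) R)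
    (summable_norm_coeff_mul hg
      (summable_norm_coeff_polynomial (Polynomial.C B.leadingCoeff⁻¹) R))
  rw [← hmap] at hs
  refine hs.congr fun n => ?_
  rw [PowerSeries.coeff_map, norm_mul, norm_pow, Complex.norm_real, Real.norm_of_nonneg hR0.le]
  simp [fCoeff]

/-- Powers of `n + 1` are `O(R^n)`, so geometric decay yields every weighted summability that the
convolution lemmas demand. -/
theorem summable_geometric_weight {u : ℕ → ℝ} {R : ℝ} (hR : 1 < R)
    (hu : Summable fun n => |u n| * R ^ n) (e : ℝ) :
    Summable fun n : ℕ => |u n| * ((n : ℝ) + 1) ^ e := by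
  refine summable_of_isBigO_nat hu ?_
  refine (Asymptotics.isBigO_refl _ _).mul ?_
  obtain ⟨k, hk⟩ := exists_nat_ge e
  have h1 : (fun n : ℕ => ((n : ℝ) + 1) ^ e) =O[atTop] fun n : ℕ => (((n + 1 : ℕ) : ℝ)) ^ k := by
    refine Asymptotics.IsBigO.of_bound 1 (Eventually.of_forall fun n => ?_)
    rw [one_mul, Real.norm_of_nonneg (by positivity), Real.norm_of_nonneg (by positivity),
      ← Real.rpow_natCast]
    push_cast
    exact Real.rpow_le_rpow_of_exponent_le (by linarith [Nat.cast_nonneg (α := ℝ) n]) hk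
  have h2 : (fun n : ℕ => (((n + 1 : ℕ) : ℝ)) ^ k) =O[atTop] fun n : ℕ => R ^ (n + 1) :=
    (isLittleO_pow_const_const_pow_of_one_lt k hR).isBigO.comp_tendsto (tendsto_add_atTop_nat 1)
  refine (h1.trans h2).trans (Asymptotics.IsBigO.of_bound R (Eventually.of_forall fun n => ?_))
  rw [pow_succ, norm_mul, mul_comm, Real.norm_of_nonneg (by linarith : 0 ≤ R)]

theorem tsum_coeff_eq_eval_one (p : Polynomial ℝ) : ∑' n, p.coeff n = p.eval 1 := by
  rw [Polynomial.eval_eq_sum, Polynomial.sum, tsum_eq_sum (s := p.support) fun n hn =>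
    Polynomial.notMem_support_iff.1 hn]
  exact Finset.sum_congr rfl fun n _ => by rw [one_pow, mul_one]

/-- `∑ f_k = f(1) ≠ 0`. -/
theorem tsum_fCoeff_ne_zero {α β : Polynomial ℝ} (hβ0 : β.coeff 0 = 1)
    (hf : Summable fun n => |fCoeff α β n|) (hα : α.eval 1 ≠ 0) : ∑' n, fCoeff α β n ≠ 0 := by
  have hβs : Summable fun n => ‖β.coeff n‖ :=
    summable_of_ne_finset_zero (s := β.support) fun n hn => by
      rw [Polynomial.notMem_support_iff.1 hn, norm_zero]
  have h := tsum_mul_tsum_eq_tsum_sum_antidiagonal_of_summable_norm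
    (f := fun n => fCoeff α β n) (g := fun n => β.coeff n) hf hβs
  have h2 : ∀ n, ∑ kl ∈ HasAntidiagonal.antidiagonal n, fCoeff α β kl.1 * β.coeff kl.2 =
      α.coeff n := by
    intro n
    rw [← Polynomial.coeff_coe α, ← fSeries_mul (α := α) hβ0, PowerSeries.coeff_mul]
    exact Finset.sum_congr rfl fun kl _ => by rw [Polynomial.coeff_coe, fCoeff]
  rw [tsum_congr h2, tsum_coeff_eq_eval_one, tsum_coeff_eq_eval_one] at h
  intro h0
  rw [h0, zero_mul] at h
  exact hα h.symm

/-! ### Residue classes modulo `s` -/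

/-- `λ_{d,sm+q}` as a convolution of `δ` with the `q`-th residue class of `f`. -/
theorem lamCoeff_eq (α β : Polynomial ℝ) {s : ℕ} (d : ℝ) (m : ℕ) {q : ℕ} (hq : q < s) :
    lamCoeff α β s d (s * m + q) =
      ∑ i ∈ range (m + 1), fCoeff α β (s * i + q) * deltaCoeff d (m - i) := by
  have hs : 0 < s := by omega
  rw [lamCoeff, PowerSeries.coeff_mul]
  symm
  refine Finset.sum_of_injOn (fun i => (s * i + q, s * (m - i))) ?_ ?_ ?_ ?_
  · intro i _ j _ h
    have := congrArg Prod.fst h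
    simp only [Nat.add_right_cancel_iff] at this
    exact Nat.eq_of_mul_eq_mul_left hs this
  · intro i hi
    have hi : i ≤ m := by have := mem_range.1 (mem_coe.1 hi); omega
    rw [mem_coe, HasAntidiagonal.mem_antidiagonal]
    change s * i + q + s * (m - i) = s * m + q
    have : s * m = s * i + s * (m - i) := by rw [← mul_add, Nat.add_sub_cancel' hi]
    omega
  · rintro ⟨a, b⟩ hab hn
    rw [HasAntidiagonal.mem_antidiagonal] at hab
    simp only at hab
    rw [PowerSeries.coeff_mk, piCoeff]
    by_cases hb : s ∣ b
    · exfalso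
      obtain ⟨c, rfl⟩ := hb
      -- Here `q < s` enters: `s c ≤ s m + q < s (m + 1)`.
      have hc : c ≤ m := by
        by_contra h
        have : s * (m + 1) ≤ s * c := Nat.mul_le_mul_left s (by omega)
        rw [mul_add] at this
        omega
      refine hn ⟨m - c, by simp, ?_⟩
      have : s * m = s * (m - c) + s * c := by rw [← mul_add, Nat.sub_add_cancel hc]
      have h2 : m - (m - c) = c := by omega
      simp only [h2, Prod.mk.injEq, and_true]
      omega
    · rw [if_neg hb, mul_zero]
  · intro i hi
    simp only [PowerSeries.coeff_mk]
    rw [piCoeff, if_pos (Dvd.intro _ rfl), Nat.mul_div_cancel_left _ hs, fCoeff]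

/-- Splitting a series into residue classes modulo `s`. -/
theorem tsum_residues {x : ℕ → ℝ} (hx : Summable x) {s : ℕ} (hs : 0 < s) :
    ∑' n, x n = ∑ q ∈ range s, ∑' i, x (s * i + q) := by
  have : NeZero s := ⟨hs.ne'⟩
  have h := (Nat.divModEquiv s).symm.tsum_eq x
  have h2 : Summable fun p : ℕ × Fin s => x ((Nat.divModEquiv s).symm p) :=
    (Nat.divModEquiv s).symm.summable_iff.2 hx
  rw [← h, ← (Equiv.prodComm (Fin s) ℕ).tsum_eq]
  have h3 : Summable fun p : Fin s × ℕ =>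
      x ((Nat.divModEquiv s).symm (Equiv.prodComm (Fin s) ℕ p)) :=
    (Equiv.prodComm (Fin s) ℕ).summable_iff.2 h2
  rw [Summable.tsum_prod h3, tsum_fintype,
    ← Fin.sum_univ_eq_sum_range (fun q => ∑' i, x (s * i + q))]
  simp [mul_comm]

theorem tsum_residues_int {x : ℤ → ℝ} (hx : Summable x) {s : ℕ} (hs : 0 < s) :
    ∑' n, x n = ∑ q ∈ range s, ∑' i : ℤ, x (s * i + (q : ℤ)) := by
  have : NeZero s := ⟨hs.ne'⟩
  have h := (Int.divModEquiv s).symm.tsum_eq x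
  have h2 : Summable fun p : ℤ × Fin s => x ((Int.divModEquiv s).symm p) :=
    (Int.divModEquiv s).symm.summable_iff.2 hx
  rw [← h, ← (Equiv.prodComm (Fin s) ℤ).tsum_eq]
  have h3 : Summable fun p : Fin s × ℤ =>
      x ((Int.divModEquiv s).symm (Equiv.prodComm (Fin s) ℤ p)) :=
    (Equiv.prodComm (Fin s) ℤ).summable_iff.2 h2
  rw [Summable.tsum_prod h3, tsum_fintype,
    ← Fin.sum_univ_eq_sum_range (fun q => ∑' i : ℤ, x (s * i + (q : ℤ)))]
  simp [mul_comm]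

/-! ### Decay and total mass of `γ_A` -/

/-- The second factor `f_{i+|n|}` is at most a constant times `R^(-|n|)`, uniformly in `i`, and `∑
|f_i|` remains. -/
theorem exists_gammaA_bound {α β : Polynomial ℝ} {R : ℝ} (hR : 1 < R)
    (hf : Summable fun n => |fCoeff α β n| * R ^ n) :
    ∃ C, ∀ n : ℤ, |gammaA α β n| ≤ C * (R⁻¹) ^ n.natAbs := by
  have hf1 : Summable fun n => |fCoeff α β n| := by
    simpa using summable_geometric_weight hR hf 0
  have hb : ∀ n, |fCoeff α β n| * R ^ n ≤ ∑' n, |fCoeff α β n| * R ^ n := fun n =>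
    hf.le_tsum n fun _ _ => by positivity
  set D := ∑' n, |fCoeff α β n| * R ^ n with hD
  have hb' : ∀ n, |fCoeff α β n| ≤ D * (R⁻¹) ^ n := fun n => by
    rw [inv_pow, ← div_eq_mul_inv, le_div_iff₀ (by positivity)]; exact hb n
  have hD0 : 0 ≤ D := tsum_nonneg fun n => by positivity
  have hRi : R⁻¹ ≤ 1 := inv_le_one_of_one_le₀ hR.le
  have hRi0 : 0 ≤ R⁻¹ := by positivity
  refine ⟨(∑' n, |fCoeff α β n|) * D, fun n => ?_⟩
  have hterm : ∀ i, |fCoeff α β i * fCoeff α β (i + n.natAbs)| ≤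
      |fCoeff α β i| * (D * (R⁻¹) ^ n.natAbs) := fun i => by
    rw [abs_mul]
    refine mul_le_mul_of_nonneg_left ((hb' _).trans ?_) (abs_nonneg _)
    exact mul_le_mul_of_nonneg_left
      (pow_le_pow_of_le_one hRi0 hRi (Nat.le_add_left _ _)) hD0
  have := tsum_of_norm_bounded (f := fun i => fCoeff α β i * fCoeff α β (i + n.natAbs))
    (hf1.mul_right (D * (R⁻¹) ^ n.natAbs)).hasSum hterm
  rw [tsum_mul_right, ← mul_assoc] at this
  exact this

theorem summable_gammaA_weight {α β : Polynomial ℝ} {R : ℝ} (hR : 1 < R)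
    (hf : Summable fun n => |fCoeff α β n| * R ^ n) (e : ℝ) :
    Summable fun n : ℤ => |gammaA α β n| * ((n.natAbs : ℝ) + 1) ^ e := by
  obtain ⟨C, hC⟩ := exists_gammaA_bound hR hf
  -- A slightly smaller radius is needed, because `R^(-n)` is not summable against `R^n` but is
  -- against `R'^n`.
  obtain ⟨R', h1, h2⟩ := exists_between hR
  have hR'0 : 0 < R' := one_pos.trans h1
  have hgeo : Summable fun n : ℕ => |(R⁻¹) ^ n| * R' ^ n := by
    have : Summable fun n : ℕ => (R' / R) ^ n :=
      summable_geometric_of_lt_one (by positivity) ((div_lt_one (by positivity)).2 h2)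
    refine this.congr fun n => ?_
    rw [abs_of_nonneg (by positivity), div_pow, inv_pow]
    ring
  have hs : Summable fun n : ℕ => C * (|(R⁻¹) ^ n| * ((n : ℝ) + 1) ^ e) :=
    (summable_geometric_weight h1 hgeo e).mul_left C
  have hbd : ∀ n : ℤ, |gammaA α β n| * ((n.natAbs : ℝ) + 1) ^ e ≤
      C * (|(R⁻¹) ^ n.natAbs| * ((n.natAbs : ℝ) + 1) ^ e) := fun n => by
    rw [abs_of_nonneg (by positivity : (0 : ℝ) ≤ (R⁻¹) ^ n.natAbs), ← mul_assoc]
    exact mul_le_mul_of_nonneg_right (hC n) (by positivity)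
  refine Summable.of_nat_of_neg ?_ ?_ <;>
  · refine Summable.of_nonneg_of_le (fun n => by positivity) (fun n => hbd _) ?_
    simpa using hs

/-- `∑_{n ∈ ℤ} γ_A(n) = f(1)²`. -/
theorem tsum_gammaA {α β : Polynomial ℝ} (hf : Summable fun n => |fCoeff α β n|) :
    ∑' n : ℤ, gammaA α β n = (∑' n, fCoeff α β n) ^ 2 := by
  set F : ℤ → ℝ := Function.extend (fun n : ℕ => (n : ℤ)) (fCoeff α β) 0 with hF
  have hinj : Function.Injective fun n : ℕ => (n : ℤ) := Nat.cast_injective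
  have hFn : ∀ n : ℕ, F n = fCoeff α β n := fun n => hinj.extend_apply _ _ _
  have hF0 : ∀ n : ℤ, n < 0 → F n = 0 := fun n hn => by
    rw [hF, Function.extend_apply' _ _ _ (by rintro ⟨m, rfl⟩; exact absurd hn (by simp))]; rfl
  have hsupp : ∀ x : ℤ → ℝ, (∀ n < 0, x n = 0) →
      Function.support x ⊆ Set.range fun n : ℕ => (n : ℤ) := by
    intro x hx n hn
    by_cases h : n < 0
    · exact absurd (hx n h) hn
    · exact ⟨n.toNat, by simp; omega⟩
  have hFs : Summable fun n => ‖F n‖ := by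
    rw [← hinj.summable_iff]
    · refine hf.congr fun n => ?_
      simp [hFn]
    · intro n hn
      rw [hF0 n, norm_zero]
      by_contra h
      exact hn ⟨n.toNat, by simp; omega⟩
  have hFt : ∑' n, F n = ∑' n, fCoeff α β n := by
    rw [← hinj.tsum_eq (hsupp F hF0)]
    exact tsum_congr hFn
  have hprod : Summable fun p : ℤ × ℤ => F p.1 * F p.2 := summable_mul_of_summable_norm hFs hFs
  have hval : ∑' p : ℤ × ℤ, F p.1 * F p.2 = (∑' n, fCoeff α β n) ^ 2 := by
    rw [← hFt, sq, tsum_mul_tsum_of_summable_norm hFs hFs]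
  -- With `f` extended by zero to `ℤ`, the double series for `f(1)²` is reindexed by lag and
  -- position, `(n, i) ↦ (i, i + n)`; the inner sum is then `γ_A(n)`.
  let E : ℤ × ℤ ≃ ℤ × ℤ :=
    { toFun := fun p => (p.2, p.2 + p.1)
      invFun := fun p => (p.2 - p.1, p.1)
      left_inv := fun p => by simp
      right_inv := fun p => by simp }
  have hE : Summable fun p : ℤ × ℤ => F (E p).1 * F (E p).2 := E.summable_iff.2 hprod
  rw [← hval, ← E.tsum_eq, Summable.tsum_prod hE]
  refine tsum_congr fun n => ?_
  simp only [E, Equiv.coe_fn_mk]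
  rw [gammaA]
  rcases le_or_gt 0 n with hn | hn
  · rw [← hinj.tsum_eq (hsupp _ fun i hi => by rw [hF0 i hi, zero_mul])]
    refine tsum_congr fun i => ?_
    have : (i : ℤ) + n = ((i + n.natAbs : ℕ) : ℤ) := by omega
    rw [this, hFn, hFn]
  · rw [← (Equiv.addRight (-n)).tsum_eq fun i => F i * F (i + n)]
    rw [← hinj.tsum_eq (hsupp _ fun i hi => by
      simp only [Equiv.coe_addRight, neg_add_cancel_right, hF0 i hi, mul_zero])]
    refine tsum_congr fun i => ?_
    have : (i : ℤ) + -n = ((i + n.natAbs : ℕ) : ℤ) := by omega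
    simp only [Equiv.coe_addRight, neg_add_cancel_right]
    rw [this, hFn, hFn, mul_comm]

/-! ### Quotients, two-sided convolutions and blocks -/

namespace HasRate

variable {a b : ℕ → ℝ} {e e' A B : ℝ}

theorem of_shift {k : ℕ} (ha : HasRate (fun n => a (n + k)) e A) : HasRate a e A :=
  (tendsto_add_atTop_iff_nat k).1 (ha.tendsto_shift k)

theorem div (ha : HasRate a e A) (hb : HasRate b e' B) (hB : B ≠ 0) :
    HasRate (fun n => a n / b n) (e - e') (A / B) := by
  refine (Tendsto.div ha hb hB).congr fun n => ?_
  rw [Real.rpow_sub (by positivity)]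
  exact mul_div_mul_comm _ _ _ _

/-- Any sequence `b` with the same nonzero limit may replace the constant `A`. This lets the
`h`-dependent factors of the theorem stand for their limits. -/
theorem isEquivalent (ha : HasRate a e A) (hA : A ≠ 0) (hb : Tendsto b atTop (𝓝 A)) :
    Asymptotics.IsEquivalent atTop a fun h : ℕ => b h * (h : ℝ) ^ (-e) := by
  have h1 : Tendsto (fun n : ℕ => a n * ((n : ℝ) + 1) ^ e /
      (b n * (((n : ℝ) + 1 + -1) / ((n : ℝ) + 1)) ^ (-e))) atTop (𝓝 1) := by
    have := Tendsto.div ha (hb.mul (tendsto_rpow_ratio (-1) (-e))) (by rwa [mul_one])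
    rwa [mul_one, div_self hA] at this
  refine Asymptotics.isEquivalent_of_tendsto_one (h1.congr' ?_)
  filter_upwards [eventually_gt_atTop 0] with n hn
  have hn' : (0 : ℝ) < n := by exact_mod_cast hn
  have e1 : (n : ℝ) + 1 + -1 = n := by ring
  have e3 : ((n : ℝ) + 1) ^ e ≠ 0 := by positivity
  rw [Pi.div_apply, e1, Real.div_rpow hn'.le (by positivity),
    Real.rpow_neg (by positivity : (0 : ℝ) ≤ (n : ℝ) + 1), div_inv_eq_mul, ← mul_assoc,
    mul_div_mul_right _ _ e3]

/-- Two-sided truncated convolution with a sequence that decays faster keeps the rate. -/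
theorem conv_int {u : ℤ → ℝ} (he : 0 ≤ e)
    (hu : Summable fun k : ℤ => |u k| * ((k.natAbs : ℝ) + 1) ^ e)
    (ha : HasRate a e A) {N : ℕ → ℕ} (hN : ∀ n, N n ≤ n) (hN' : Tendsto N atTop atTop) :
    HasRate (fun n => ∑ k ∈ Icc (-(N n : ℤ)) (N n : ℤ), u k * a ((n : ℤ) - k).toNat) e
      (A * ∑' k, u k) := by
  obtain ⟨C, hC0, hC⟩ := ha.exists_bound
  have key := tendsto_tsum_of_dominated_convergence
    (f := fun (n : ℕ) k => if k ∈ Icc (-(N n : ℤ)) (N n : ℤ) then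
      u k * (a ((n : ℤ) - k).toNat * ((n : ℝ) + 1) ^ e) else 0)
    (g := fun k => u k * A) (𝓕 := atTop) (hu.mul_left C) ?_ ?_
  · rw [tsum_mul_right, mul_comm] at key
    refine key.congr fun n => ?_
    rw [tsum_eq_sum (s := Icc (-(N n : ℤ)) (N n : ℤ)) fun i hi => if_neg hi, Finset.sum_mul]
    exact Finset.sum_congr rfl fun i hi => by rw [if_pos hi, mul_assoc]
  · intro k
    have h1 : Tendsto (fun n : ℕ => ((((n : ℤ) - k).toNat : ℝ) + 1) / ((n : ℝ) + 1)) atTop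
        (𝓝 1) := by
      refine (tendsto_add_const_div_add_one (-(k : ℝ))).congr' ?_
      filter_upwards [eventually_ge_atTop k.natAbs] with n hn
      have : ((((n : ℤ) - k).toNat : ℤ) : ℝ) = (((n : ℤ) - k : ℤ) : ℝ) := by
        rw [Int.toNat_of_nonneg (by omega)]
      push_cast at this
      rw [this]
      ring
    have h2 := (ha.tendsto_comp one_pos h1).const_mul (u k)
    rw [Real.one_rpow, mul_one] at h2
    refine h2.congr' ?_
    filter_upwards [hN'.eventually_ge_atTop k.natAbs] with n hn
    rw [if_pos (mem_Icc.2 (by omega))]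
  · refine Eventually.of_forall fun n k => ?_
    split_ifs with hk
    · have hkn : k ≤ n := by have := hN n; have := (mem_Icc.1 hk).2; omega
      set m := ((n : ℤ) - k).toNat with hm
      have hle : ((n : ℝ) + 1) ^ e ≤ ((m : ℝ) + 1) ^ e * ((k.natAbs : ℝ) + 1) ^ e := by
        rw [← Real.mul_rpow (by positivity) (by positivity)]
        refine Real.rpow_le_rpow (by positivity) ?_ he
        have : (n : ℝ) ≤ (m : ℝ) + (k.natAbs : ℝ) := by
          exact_mod_cast (by omega : n ≤ m + k.natAbs)
        nlinarith [Nat.cast_nonneg (α := ℝ) m, Nat.cast_nonneg (α := ℝ) k.natAbs]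
      rw [norm_mul, norm_mul, Real.norm_eq_abs, Real.norm_eq_abs,
        Real.norm_of_nonneg (by positivity)]
      have h2 : |a m| * ((n : ℝ) + 1) ^ e ≤ C * ((k.natAbs : ℝ) + 1) ^ e := by
        calc _ ≤ (C * ((m : ℝ) + 1) ^ (-e)) *
              (((m : ℝ) + 1) ^ e * ((k.natAbs : ℝ) + 1) ^ e) := by
              gcongr
              exact hC m
          _ = C * (((m : ℝ) + 1) ^ (-e + e)) * ((k.natAbs : ℝ) + 1) ^ e := by
            rw [Real.rpow_add (by positivity)]; ring
          _ = _ := by simp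
      calc _ ≤ |u k| * (C * ((k.natAbs : ℝ) + 1) ^ e) := by gcongr
        _ = _ := by ring
    · rw [norm_zero]; positivity

/-- If every residue class modulo `s` has a rate, so do the sums over `s` consecutive indices. -/
theorem block {x : ℕ → ℝ} {s : ℕ} {L : ℕ → ℝ}
    (h : ∀ q < s, HasRate (fun m => x (s * m + q)) e (L q)) {q : ℕ} (hq : q ≤ s) :
    HasRate (fun m => ∑ r ∈ range s, x (s * m + q + r)) e (∑ r ∈ range s, L r) := by
  induction q with
  | zero => exact HasRate.sum _ fun r hr => h r (mem_range.1 hr)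
  | succ q ih =>
    -- Sliding the window by one removes index `s m + q` and adds `s (m + 1) + q`; both lie in the
    -- same residue class, so the limit is unchanged.
    have h1 := h q hq
    have h2 := ((ih (by omega)).add (h1.shift 1)).add (h1.const_mul (-1))
    have e1 : (∑ r ∈ range s, L r) + L q + -1 * L q = ∑ r ∈ range s, L r := by ring
    rw [e1] at h2
    refine h2.congr' (Eventually.of_forall fun m => ?_)
    have h3 := Finset.sum_range_succ (fun r => x (s * m + q + r)) s
    rw [Finset.sum_range_succ'] at h3
    have e2 : s * m + q + s = s * (m + 1) + q := by ring
    have e3 : ∀ r, s * m + q + (r + 1) = s * m + (q + 1) + r := fun r => by ring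
    simp only [e2, e3, add_zero] at h3
    linarith

/-- The blocks of `s` consecutive indices ending at `s * h + s - 2`. -/
theorem block_pred {x : ℕ → ℝ} {s : ℕ} (hs : 0 < s) {L : ℕ → ℝ}
    (h : ∀ q < s, HasRate (fun m => x (s * m + q)) e (L q)) :
    HasRate (fun m => ∑ r ∈ range s, x (s * m + r - 1)) e (∑ r ∈ range s, L r) := by
  -- At `m = 0`, `r = 0` the natural subtraction truncates. After the shift the block starts at `s
  -- (m + 1) - 1 = s m + (s - 1)`, an ordinary window.
  refine HasRate.of_shift (k := 1) ?_
  refine (block h (q := s - 1) (by omega)).congr' (Eventually.of_forall fun m => ?_)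
  refine Finset.sum_congr rfl fun r _ => congrArg x ?_
  rw [mul_add]
  omega

end HasRate

/-! ### Asymptotics of `λ`, its correlations and the factors `calC1`, `calC2` -/

section Coefficients

variable {α β : Polynomial ℝ} {s : ℕ} {d R : ℝ}

theorem summable_fCoeff_residue (hs : 0 < s) (hR : 1 < R)
    (hf : Summable fun n => |fCoeff α β n| * R ^ n) {e : ℝ} (he : 0 ≤ e) (q : ℕ) :
    Summable fun i : ℕ => |fCoeff α β (s * i + q)| * ((i : ℝ) + 1) ^ e := by
  have hinj : Function.Injective fun i : ℕ => s * i + q := fun i j h => by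
    simpa [hs.ne'] using h
  refine Summable.of_nonneg_of_le (fun i => by positivity) (fun i => ?_)
    ((summable_geometric_weight hR hf e).comp_injective hinj)
  refine mul_le_mul_of_nonneg_left (Real.rpow_le_rpow (by positivity) ?_ he) (abs_nonneg _)
  have : i ≤ s * i + q := (Nat.le_mul_of_pos_left i hs).trans (Nat.le_add_right _ _)
  have : (i : ℝ) ≤ ((s * i + q : ℕ) : ℝ) := by exact_mod_cast this
  linarith

theorem summable_abs_fCoeff (hR : 1 < R) (hf : Summable fun n => |fCoeff α β n| * R ^ n) :
    Summable fun n => |fCoeff α β n| := by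
  simpa using summable_geometric_weight hR hf 0

theorem hasRate_lamCoeff (hR : 1 < R) (hf : Summable fun n => |fCoeff α β n| * R ^ n)
    (hd : d < 1) {q : ℕ} (hq : q < s) :
    HasRate (fun m => lamCoeff α β s d (s * m + q)) (1 - d)
      ((Real.Gamma d)⁻¹ * ∑' i, fCoeff α β (s * i + q)) := by
  simp only [lamCoeff_eq α β d _ hq]
  exact (hasRate_deltaCoeff d).conv (by linarith)
    (summable_fCoeff_residue (by omega) hR hf (by linarith) q) (fun n => le_refl n) tendsto_id

theorem sum_tsum_fCoeff (hs : 0 < s) (hR : 1 < R)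
    (hf : Summable fun n => |fCoeff α β n| * R ^ n) :
    ∑ q ∈ range s, ∑' i, fCoeff α β (s * i + q) = ∑' n, fCoeff α β n :=
  (tsum_residues (summable_abs_fCoeff hR hf).of_abs hs).symm

theorem hasRate_sum_lamCoeff (hR : 1 < R) (hf : Summable fun n => |fCoeff α β n| * R ^ n)
    (hd : d < 1) {q : ℕ} (hq : q < s) :
    HasRate (fun m => ∑ r ∈ range s, lamCoeff α β s d (s * m + q + r)) (1 - d)
      ((Real.Gamma d)⁻¹ * ∑' n, fCoeff α β n) := by
  have h := HasRate.block (fun q hq => hasRate_lamCoeff (d := d) hR hf hd hq) hq.le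
  rwa [← Finset.mul_sum, sum_tsum_fCoeff (by omega) hR hf] at h

theorem hasRate_sum_lamCoeff_pred (hs : 0 < s) (hR : 1 < R)
    (hf : Summable fun n => |fCoeff α β n| * R ^ n) (hd : d < 1) :
    HasRate (fun m => ∑ r ∈ range s, lamCoeff α β s d (s * m + r - 1)) (1 - d)
      ((Real.Gamma d)⁻¹ * ∑' n, fCoeff α β n) := by
  have h := HasRate.block_pred hs (fun q hq => hasRate_lamCoeff (d := d) hR hf hd hq)
  rwa [← Finset.mul_sum, sum_tsum_fCoeff hs hR hf] at h

theorem summable_of_residues {x : ℕ → ℝ} (hx0 : ∀ n, 0 ≤ x n) (hs : 0 < s)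
    (hx : ∀ q < s, Summable fun i => x (s * i + q)) : Summable x := by
  have : NeZero s := ⟨hs.ne'⟩
  rw [← (Nat.divModEquiv s).symm.summable_iff, ← (Equiv.prodComm (Fin s) ℕ).summable_iff]
  refine (summable_prod_of_nonneg fun p => hx0 _).2 ⟨fun q => ?_, (hasSum_fintype _).summable⟩
  simpa [mul_comm] using hx q q.2

/-- On each class the squares are `O(m^(2d-2))`, summable exactly because `d < 1/2` gives `2(1 - d)
> 1`. -/
theorem summable_lamCoeff_sq (hs : 0 < s) (hR : 1 < R)
    (hf : Summable fun n => |fCoeff α β n| * R ^ n) (hd : d < 1 / 2) :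
    Summable fun n => lamCoeff α β s d n ^ 2 := by
  refine summable_of_residues (fun n => sq_nonneg _) hs fun q hq => ?_
  have h := hasRate_lamCoeff (d := d) hR hf (by linarith) hq
  exact (h.summable_mul h (by linarith) 0).congr fun i => (sq _).symm

theorem summable_lamCoeff_mul (hs : 0 < s) (hR : 1 < R)
    (hf : Summable fun n => |fCoeff α β n| * R ^ n) (hd : d < 1 / 2) (n : ℕ) :
    Summable fun k => lamCoeff α β s d k * lamCoeff α β s d (k + n) := by
  have h := summable_lamCoeff_sq (d := d) hs hR hf hd
  refine Summable.of_norm_bounded (h.add ((summable_nat_add_iff n).2 h)) fun k => ?_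
  rw [norm_mul, Real.norm_eq_abs, Real.norm_eq_abs]
  nlinarith [sq_nonneg (|lamCoeff α β s d k| - |lamCoeff α β s d (k + n)|),
    sq_abs (lamCoeff α β s d k), sq_abs (lamCoeff α β s d (k + n)),
    sq_nonneg (lamCoeff α β s d k), sq_nonneg (lamCoeff α β s d (k + n))]

/-- `∑_k λ_k λ_{k+n}`, the autocovariance at lag `n` of the linear process with coefficients
`λ` and unit innovation variance. -/
noncomputable def lamCorr (α β : Polynomial ℝ) (s : ℕ) (d : ℝ) (n : ℕ) : ℝ :=
  ∑' k, lamCoeff α β s d k * lamCoeff α β s d (k + n)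

/-- Only the first factor is split into residue classes; the sum over `r` stays with the second,
which becomes a block sum whose rate constant `f(1)/Γ(d)` does not depend on `q`. -/
theorem sum_lamCorr (hs : 0 < s) (hR : 1 < R)
    (hf : Summable fun n => |fCoeff α β n| * R ^ n) (hd : d < 1 / 2) (h : ℕ) :
    ∑ r ∈ range s, lamCorr α β s d (s * h + r) =
      ∑ q ∈ range s, ∑' i, lamCoeff α β s d (s * i + q) *
        ∑ r ∈ range s, lamCoeff α β s d (s * (i + h) + q + r) := by
  have hsum : ∀ r, Summable fun k => lamCoeff α β s d k * lamCoeff α β s d (k + (s * h + r)) :=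
    fun r => summable_lamCoeff_mul hs hR hf hd _
  simp only [lamCorr]
  rw [← Summable.tsum_finsetSum fun r _ => hsum r, tsum_residues (summable_sum fun r _ => hsum r) hs]
  refine Finset.sum_congr rfl fun q _ => tsum_congr fun i => ?_
  rw [Finset.mul_sum]
  refine Finset.sum_congr rfl fun r _ => ?_
  congr 2
  ring

/-- Class `q` contributes its share of `f(1)` times `f(1)/Γ(d)²` times the Beta constant; the shares
add up to `f(1)²`, and one `Γ(d)` cancels. -/
theorem hasRate_sum_lamCorr_of_pos (hs : 0 < s) (hR : 1 < R)
    (hf : Summable fun n => |fCoeff α β n| * R ^ n) (hd0 : 0 < d) (hd : d < 1 / 2) :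
    HasRate (fun h => ∑ r ∈ range s, lamCorr α β s d (s * h + r)) (1 - 2 * d)
      (Real.Gamma (1 - 2 * d) / (Real.Gamma (1 - d) * Real.Gamma d) *
        (∑' n, fCoeff α β n) ^ 2) := by
  simp only [sum_lamCorr hs hR hf hd]
  have h := HasRate.sum (range s) fun q hq =>
    (hasRate_lamCoeff (d := d) hR hf (by linarith) (mem_range.1 hq)).corr hd0 hd
      (hasRate_sum_lamCoeff (d := d) hR hf (by linarith) (mem_range.1 hq))
  convert h using 1
  rw [← Finset.sum_mul, ← Finset.sum_mul, ← Finset.mul_sum, sum_tsum_fCoeff hs hR hf]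
  have h1 : Real.Gamma d ≠ 0 := (Real.Gamma_pos_of_pos hd0).ne'
  field_simp

/-- Taking partial sums multiplies the generating function by `(1 - x)^(-1)`. -/
theorem sum_deltaCoeff (d : ℝ) (n : ℕ) :
    ∑ j ∈ range (n + 1), deltaCoeff d j = deltaCoeff (d + 1) n := by
  have hleft : ∀ n : ℕ, (ascPochhammer ℝ (n + 1)).eval d = d * (ascPochhammer ℝ n).eval (d + 1) := by
    intro n
    rw [ascPochhammer_succ_left]
    simp
  induction n with
  | zero => simp [deltaCoeff]
  | succ n ih =>
    rw [Finset.sum_range_succ, ih, deltaCoeff, deltaCoeff, deltaCoeff, hleft,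
      ascPochhammer_succ_eval, Nat.factorial_succ]
    have : (n.factorial : ℝ) ≠ 0 := by positivity
    push_cast
    field_simp
    ring

/-- The partial sums are the coefficients `δ_{d+1,n}`, which are `O(n^d)` and vanish in the limit as
`d < 0`. -/
theorem tsum_deltaCoeff (hd : d < 0) : ∑' j, deltaCoeff d j = 0 := by
  have hs : Summable (deltaCoeff d) := ((hasRate_deltaCoeff d).summable_abs (by linarith)).of_abs
  have h1 := (tendsto_add_atTop_iff_nat 1).2 hs.hasSum.tendsto_sum_nat
  simp only [sum_deltaCoeff] at h1
  have h2 := (hasRate_deltaCoeff (d + 1)).of_lt (e' := 0) (by linarith)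
  simp only [HasRate, Real.rpow_zero, mul_one] at h2
  exact tendsto_nhds_unique h1 h2

theorem tsum_lamCoeff_residue (hR : 1 < R) (hf : Summable fun n => |fCoeff α β n| * R ^ n)
    (hd : d < 0) {q : ℕ} (hq : q < s) : ∑' i, lamCoeff α β s d (s * i + q) = 0 := by
  simp only [lamCoeff_eq α β d _ hq]
  have h1 : Summable fun i => ‖fCoeff α β (s * i + q)‖ := by
    simpa using summable_fCoeff_residue (s := s) (by omega) hR hf le_rfl q
  have h2 : Summable fun i => ‖deltaCoeff d i‖ :=
    (hasRate_deltaCoeff d).summable_abs (by linarith)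
  rw [← tsum_mul_tsum_eq_tsum_sum_range_of_summable_norm h1 h2, tsum_deltaCoeff hd, mul_zero]

/-- For `d < 0` the sequence `λ` is absolutely summable, so correlating multiplies the block rate by
its sum over each class; those sums vanish, which kills the `h^(d-1)` term. -/
theorem hasRate_sum_lamCorr_of_neg (hs : 0 < s) (hR : 1 < R)
    (hf : Summable fun n => |fCoeff α β n| * R ^ n) (hd : d < 0) :
    HasRate (fun h => ∑ r ∈ range s, lamCorr α β s d (s * h + r)) (1 - d) 0 := by
  simp only [sum_lamCorr hs hR hf (by linarith : d < 1 / 2)]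
  have h := HasRate.sum (range s) fun q hq =>
    (hasRate_sum_lamCoeff (d := d) hR hf (by linarith) (mem_range.1 hq)).corr_of_summable
      (by linarith)
      ((hasRate_lamCoeff (d := d) hR hf (by linarith) (mem_range.1 hq)).summable_abs (by linarith))
  rwa [Finset.sum_eq_zero fun q hq => by
    rw [tsum_lamCoeff_residue hR hf hd (mem_range.1 hq), zero_mul]] at h

theorem tendsto_nat_sqrt : Tendsto Nat.sqrt atTop atTop :=
  tendsto_atTop.2 fun b => (eventually_ge_atTop (b * b)).mono fun _ hn => Nat.le_sqrt.2 hn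

theorem mul_add_div_mod {r : ℕ} (hr : r < s) (m : ℕ) : (s * m + r) / s = m ∧ (s * m + r) % s = r := by
  have hs : 0 < s := by omega
  constructor
  · rw [Nat.mul_add_div hs, Nat.div_eq_of_lt hr, add_zero]
  · rw [Nat.mul_add_mod, Nat.mod_eq_of_lt hr]

/-- Numerator and denominator share the rate of `δ`, so the quotient converges. The truncation level
`√m` matters only through `√m ≤ m` and `√m → ∞`. -/
theorem hasRate_calK (hR : 1 < R) (hf : Summable fun n => |fCoeff α β n| * R ^ n) (hd : d < 1)
    (hG : Real.Gamma d ≠ 0) {r : ℕ} (hr : r < s) :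
    HasRate (fun m => calK α β s d (s * m + r)) 0 (∑' i, fCoeff α β (s * i + r)) := by
  have hs : 0 < s := by omega
  have h1 := (hasRate_deltaCoeff d).conv (by linarith)
    (summable_fCoeff_residue (s := s) hs hR hf (by linarith : 0 ≤ 1 - d) r) Nat.sqrt_le_self
    tendsto_nat_sqrt
  have h2 := h1.div (hasRate_deltaCoeff d) (inv_ne_zero hG)
  rw [sub_self, mul_div_cancel_left₀ _ (inv_ne_zero hG)] at h2
  refine h2.congr' (Eventually.of_forall fun m => ?_)
  obtain ⟨e1, e2⟩ := mul_add_div_mod hr m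
  rw [calK, e1, e2, Finset.sum_div]
  refine Finset.sum_congr rfl fun j _ => ?_
  rw [← Nat.mul_sub, piCoeff, piCoeff, if_pos (Dvd.intro _ rfl), if_pos (Dvd.intro _ rfl),
    Nat.mul_div_cancel_left _ hs, Nat.mul_div_cancel_left _ hs, mul_div_assoc]

theorem tendsto_calC2 (hs : 0 < s) (hR : 1 < R)
    (hf : Summable fun n => |fCoeff α β n| * R ^ n) (hd : d < 1) (hG : Real.Gamma d ≠ 0) :
    Tendsto (calC2 α β s d) atTop (𝓝 ((Real.Gamma d)⁻¹ * ∑' n, fCoeff α β n)) := by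
  have h := HasRate.block_pred hs fun r hr => hasRate_calK hR hf hd hG hr
  rw [sum_tsum_fCoeff hs hR hf] at h
  have h2 := Tendsto.const_mul (Real.Gamma d)⁻¹ h
  refine h2.congr fun m => ?_
  rw [calC2, Real.rpow_zero, mul_one, one_div]

theorem gammaV_mul (hs : 0 < s) (v d : ℝ) (m : ℤ) :
    gammaV v s d (s * m) = v * ((-1 : ℝ) ^ m * Real.Gamma (1 - 2 * d)) /
      (Real.Gamma (1 - d + m) * Real.Gamma (1 - d - m)) := by
  rw [gammaV, if_pos (Dvd.intro _ rfl), Int.mul_ediv_cancel_left _ (by omega)]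

/-- The reflection formula at `m + d` replaces `Γ(1-d-m)` by a multiple of `(-1)^m / Γ(m+d)`,
cancelling the alternating sign. The rate of `γ_V` then follows from those of `δ_d` and `δ_{1-d}`.
-/
theorem gammaV_mul_nat (hs : 0 < s) (v : ℝ) (hd0 : 0 < d) (hd1 : d < 1) (m : ℕ) :
    gammaV v s d (s * (m : ℤ)) =
      v * Real.Gamma (1 - 2 * d) / (Real.Gamma (1 - d) ^ 2) *
        (deltaCoeff d m / deltaCoeff (1 - d) m) := by
  rw [gammaV_mul hs]
  have hpi := Real.pi_ne_zero
  have hsin : 0 < Real.sin (Real.pi * d) := Real.sin_pos_of_pos_of_lt_pi (by positivity)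
    (by nlinarith [Real.pi_pos])
  have hG := Real.Gamma_pos_of_pos hd0
  have hG1 := Real.Gamma_pos_of_pos (sub_pos.2 hd1)
  have hGm : 0 < Real.Gamma (m + d) := Real.Gamma_pos_of_pos (by positivity)
  have hGm1 : 0 < Real.Gamma (m + (1 - d)) :=
    Real.Gamma_pos_of_pos (by linarith [Nat.cast_nonneg (α := ℝ) m])
  have hfac : 0 < Real.Gamma ((m : ℝ) + 1) := Real.Gamma_pos_of_pos (by positivity)
  have hr0 := Real.Gamma_mul_Gamma_one_sub d
  have hrm := Real.Gamma_mul_Gamma_one_sub (m + d)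
  have hs2 : Real.sin (Real.pi * (m + d)) = (-1) ^ m * Real.sin (Real.pi * d) := by
    rw [mul_add, add_comm, mul_comm Real.pi (m : ℝ), Real.sin_add_nat_mul_pi]
  have e1 : 1 - ((m : ℝ) + d) = 1 - d - m := by ring
  rw [hs2, e1] at hrm
  have hne : Real.Gamma (1 - d - m) ≠ 0 := by
    intro h0
    rw [h0, mul_zero, eq_comm, div_eq_zero_iff] at hrm
    rcases hrm with h | h
    · exact hpi h
    · exact (mul_ne_zero (pow_ne_zero _ (by norm_num)) hsin.ne') h
  rw [deltaCoeff_eq_Gamma d (fun n => by linarith [Nat.cast_nonneg (α := ℝ) n]),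
    deltaCoeff_eq_Gamma (1 - d) (fun n => by linarith [Nat.cast_nonneg (α := ℝ) n])]
  have hpow : ((-1 : ℝ) ^ m) * (-1) ^ m = 1 := by
    rw [← mul_pow]; norm_num
  have hpm : ((-1 : ℝ) ^ m) ≠ 0 := pow_ne_zero _ (by norm_num)
  have key : Real.Gamma (m + d) * Real.Gamma (1 - d - m) * (-1) ^ m =
      Real.Gamma d * Real.Gamma (1 - d) := by
    rw [hrm, hr0, ← mul_one Real.pi]
    field_simp
  have e2 : 1 - d + ((m : ℤ) : ℝ) = (m : ℝ) + (1 - d) := by push_cast; ring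
  have e3 : 1 - d - ((m : ℤ) : ℝ) = 1 - d - m := by push_cast; ring
  rw [e2, e3, zpow_natCast]
  rw [div_eq_iff (mul_ne_zero hGm1.ne' hne)]
  have hG' := hG.ne'
  have hG1' := hG1.ne'
  have hGm' := hGm.ne'
  have hGm1' := hGm1.ne'
  have hfac' := hfac.ne'
  calc v * ((-1) ^ m * Real.Gamma (1 - 2 * d))
      = v * Real.Gamma (1 - 2 * d) * (-1) ^ m * (Real.Gamma d * Real.Gamma (1 - d)) /
          (Real.Gamma d * Real.Gamma (1 - d)) := by field_simp
    _ = v * Real.Gamma (1 - 2 * d) * ((-1) ^ m * (-1) ^ m) *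
          (Real.Gamma (m + d) * Real.Gamma (1 - d - m)) /
          (Real.Gamma d * Real.Gamma (1 - d)) := by rw [← key]; ring
    _ = _ := by rw [hpow]; field_simp

theorem hasRate_gammaV (hs : 0 < s) (v : ℝ) (hd0 : 0 < d) (hd : d < 1 / 2) :
    HasRate (fun m => gammaV v s d (s * (m : ℤ))) (1 - 2 * d)
      (v * Real.Gamma (1 - 2 * d) / (Real.Gamma (1 - d) * Real.Gamma d)) := by
  have hG := Real.Gamma_pos_of_pos hd0
  have hG1 : 0 < Real.Gamma (1 - d) := Real.Gamma_pos_of_pos (by linarith)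
  have h := ((hasRate_deltaCoeff d).div (hasRate_deltaCoeff (1 - d))
    (inv_ne_zero hG1.ne')).const_mul (v * Real.Gamma (1 - 2 * d) / (Real.Gamma (1 - d) ^ 2))
  simp only [gammaV_mul_nat hs v hd0 (by linarith : d < 1)]
  have e1 : 1 - d - (1 - (1 - d)) = 1 - 2 * d := by ring
  rw [e1] at h
  convert h using 1
  field_simp

theorem natAbs_le_natAbs_mul_add {r : ℕ} (hr : r < s) (k : ℤ) :
    k.natAbs ≤ ((s : ℤ) * k + (r : ℤ)).natAbs := by
  have hs : (1 : ℤ) ≤ s := by omega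
  rcases le_or_gt 0 k with hk | hk
  · have : k ≤ s * k := by nlinarith
    omega
  · have : (s : ℤ) * (k + 1) ≤ k + 1 := by nlinarith
    rw [mul_add] at this
    omega

theorem summable_gammaA_residue (hR : 1 < R) (hf : Summable fun n => |fCoeff α β n| * R ^ n)
    {e : ℝ} (he : 0 ≤ e) {r : ℕ} (hr : r < s) :
    Summable fun k : ℤ => |gammaA α β (s * k + (r : ℤ))| * ((k.natAbs : ℝ) + 1) ^ e := by
  have hinj : Function.Injective fun k : ℤ => (s : ℤ) * k + (r : ℤ) := fun i j h => by
    have : s ≠ 0 := by omega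
    simpa [this] using h
  refine Summable.of_nonneg_of_le (fun i => by positivity) (fun k => ?_)
    ((summable_gammaA_weight hR hf e).comp_injective hinj)
  refine mul_le_mul_of_nonneg_left (Real.rpow_le_rpow (by positivity) ?_ he) (abs_nonneg _)
  have : (k.natAbs : ℝ) ≤ (((s : ℤ) * k + (r : ℤ)).natAbs : ℝ) := by
    exact_mod_cast natAbs_le_natAbs_mul_add hr k
  linarith

theorem hasRate_calG (hR : 1 < R) (hf : Summable fun n => |fCoeff α β n| * R ^ n) {v : ℝ}
    (hv : v ≠ 0) (hd0 : 0 < d) (hd : d < 1 / 2) {r : ℕ} (hr : r < s) :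
    HasRate (fun m => calG v α β s d (s * m + r)) 0 (∑' k : ℤ, gammaA α β (s * k + (r : ℤ))) := by
  have hs : 0 < s := by omega
  have hc : v * Real.Gamma (1 - 2 * d) / (Real.Gamma (1 - d) * Real.Gamma d) ≠ 0 :=
    div_ne_zero (mul_ne_zero hv (Real.Gamma_pos_of_pos (by linarith)).ne')
      (mul_pos (Real.Gamma_pos_of_pos (by linarith)) (Real.Gamma_pos_of_pos hd0)).ne'
  have hW := hasRate_gammaV hs v hd0 hd
  have h1 := hW.conv_int (by linarith)
    (summable_gammaA_residue (e := 1 - 2 * d) hR hf (by linarith) hr) Nat.sqrt_le_self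
    tendsto_nat_sqrt
  have h2 := h1.div hW hc
  rw [sub_self, mul_div_cancel_left₀ _ hc] at h2
  refine h2.congr' (Eventually.of_forall fun m => ?_)
  obtain ⟨e1, e2⟩ := mul_add_div_mod hr m
  rw [calG, e1, e2, Finset.sum_div]
  refine Finset.sum_congr rfl fun k hk => ?_
  have hkm : k ≤ m := by
    have := Nat.sqrt_le_self m
    have := (mem_Icc.1 hk).2
    omega
  rw [Int.toNat_of_nonneg (by omega), mul_sub, mul_div_assoc]

/-- The limits of `𝒢` on the classes `r < s` assemble to `∑_{n ∈ ℤ} γ_A(n) = f(1)²`. -/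
theorem tendsto_calC1 (hs : 0 < s) (hR : 1 < R)
    (hf : Summable fun n => |fCoeff α β n| * R ^ n) {v : ℝ} (hv : v ≠ 0)
    (hd0 : 0 < d) (hd : d < 1 / 2) :
    Tendsto (calC1 v α β s d) atTop
      (𝓝 (v * (Real.Gamma (1 - 2 * d) / (Real.Gamma (1 - d) * Real.Gamma d)) *
        (∑' n, fCoeff α β n) ^ 2)) := by
  have hA : Summable fun n : ℤ => gammaA α β n := by
    have := summable_gammaA_weight hR hf 0
    simp only [Real.rpow_zero, mul_one] at this
    exact this.of_abs
  have h := HasRate.sum (range s) fun r hr => hasRate_calG hR hf hv hd0 hd (mem_range.1 hr)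
  rw [← tsum_residues_int hA hs, tsum_gammaA (summable_abs_fCoeff hR hf)] at h
  refine (Tendsto.const_mul _ h).congr fun m => ?_
  rw [calC1, Real.rpow_zero, mul_one]

end Coefficients

/-! ### Covariances of the process -/

section Probability

variable {Ω : Type*} [MeasurableSpace Ω] {P : Measure Ω}

theorem covariance_congr_ae {X X' Y Y' : Ω → ℝ} (hX : X =ᵐ[P] X') (hY : Y =ᵐ[P] Y') :
    cov[X, Y; P] = cov[X', Y'; P] := by
  rw [covariance, covariance, integral_congr_ae hX, integral_congr_ae hY]
  refine integral_congr_ae ?_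
  filter_upwards [hX, hY] with x h1 h2
  rw [h1, h2]

variable {α β : Polynomial ℝ} {s : ℕ} {d ω θ γ : ℝ} {Z σ X : ℤ → Ω → ℝ}

/-- The function `g` with centring constant `c`. -/
def innovFun (θ γ c z : ℝ) : ℝ := θ * z + γ * (|z| - c)

theorem measurable_innovFun (θ γ c : ℝ) : Measurable (innovFun θ γ c) := by
  unfold innovFun
  fun_prop

theorem measurable_log_sq : Measurable fun z : ℝ => Real.log (z ^ 2) := by fun_prop

namespace IsSFIEGARCH

section Distribution

variable (hX : IsSFIEGARCH P α β s d ω θ γ Z σ X)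
include hX

theorem gInnov_eq (t : ℤ) :
    gInnov P θ γ Z t = innovFun θ γ (∫ y, |Z 0 y| ∂P) ∘ Z t := by
  have h : ∫ y, |Z t y| ∂P = ∫ y, |Z 0 y| ∂P :=
    ((hX.identDistrib_Z t).comp (u := fun z : ℝ => |z|) (by fun_prop)).integral_eq
  funext x
  simp only [gInnov, innovFun, Function.comp, h]

theorem memLp_logSq_Z (hlog : MemLp (logSq Z 0) 2 P) (t : ℤ) : MemLp (logSq Z t) 2 P :=
  ((hX.identDistrib_Z t).comp measurable_log_sq).symm.memLp_snd hlog

theorem logSq_X_ae (hZ_ne : ∀ᵐ x ∂P, Z 0 x ≠ 0) (t : ℤ) :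
    logSq X t =ᵐ[P] logSq σ t + logSq Z t := by
  have hZ : ∀ᵐ x ∂P, Z t x ≠ 0 :=
    (hX.identDistrib_Z t).symm.ae_snd (p := fun z : ℝ => z ≠ 0)
      (measurableSet_singleton (0 : ℝ)).compl hZ_ne
  filter_upwards [hZ, hX.sigma_pos t, hX.X_eq t] with x h1 h2 h3
  rw [logSq, h3, Pi.add_apply, mul_pow, Real.log_mul (pow_ne_zero 2 h2.ne') (pow_ne_zero 2 h1)]
  rfl

theorem covariance_logSq_Z (hlog : MemLp (logSq Z 0) 2 P) {t u : ℤ} (h : t ≠ u) :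
    cov[logSq Z t, logSq Z u; P] = 0 :=
  ((hX.indep_Z.indepFun h).comp measurable_log_sq measurable_log_sq).covariance_eq_zero
    (hX.memLp_logSq_Z hlog t) (hX.memLp_logSq_Z hlog u)

end Distribution

end IsSFIEGARCH

variable [IsProbabilityMeasure P]

/-- Centring `W` alone suffices, and exhibits the covariance as a continuous linear functional of
`X` in L². -/
theorem covariance_eq_inner {X W : Ω → ℝ} (hX : MemLp X 2 P) (hW : MemLp W 2 P) :
    cov[X, W; P] =
      inner ℝ ((hW.sub (memLp_const (∫ x, W x ∂P))).toLp _) (hX.toLp X) := by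
  have h1 : cov[X, W; P] = ∫ x, X x * (W x - ∫ y, W y ∂P) ∂P := by
    have h0 : cov[X, fun x => W x - ∫ y, W y ∂P; P] = cov[X, W; P] :=
      covariance_sub_const_right (hW.integrable (by norm_num)) _
    have hWc : MemLp (fun x => W x - ∫ y, W y ∂P) 2 P := hW.sub (memLp_const _)
    rw [← h0, covariance_eq_sub hX hWc]
    have : ∫ x, (W x - ∫ y, W y ∂P) ∂P = 0 := by
      rw [integral_sub (hW.integrable (by norm_num)) (integrable_const _)]
      simp
    rw [this, mul_zero, sub_zero]
    rfl
  rw [h1, L2.inner_def]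
  refine integral_congr_ae ?_
  filter_upwards [hX.coeFn_toLp, (hW.sub (memLp_const (∫ x, W x ∂P))).coeFn_toLp] with x hx hw
  rw [hx, hw]
  simp

/-- A series of orthogonal square integrable variables with bounded variances and square summable
coefficients that converges almost surely also converges in `L²`. -/
theorem memLp_of_tendsto_orthogonal_series {G : ℕ → Ω → ℝ} {L : Ω → ℝ} {a : ℕ → ℝ} {c v : ℝ}
    (hG : ∀ k, MemLp (G k) 2 P) (hmean : ∀ k, ∫ x, G k x ∂P = 0)
    (hcov : ∀ i j, cov[G i, G j; P] = if i = j then v else 0)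
    (ha : Summable fun k => a k ^ 2)
    (hL : ∀ᵐ x ∂P, Tendsto (fun n => c + ∑ k ∈ range n, a k * G k x) atTop (𝓝 (L x))) :
    MemLp L 2 P ∧ ∀ W, MemLp W 2 P →
      HasSum (fun k => a k * cov[G k, W; P]) cov[L, W; P] := by
  set g : ℕ → Lp ℝ 2 P := fun k => (hG k).toLp (G k) with hg
  have hinner : ∀ i j, inner ℝ (g i) (g j) = if i = j then v else 0 := by
    intro i j
    have h := covariance_eq_inner (hG j) (hG i)
    have h2 : ((hG i).sub (memLp_const (∫ x, G i x ∂P))).toLp _ = g i := by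
      refine (MemLp.toLp_eq_toLp_iff _ _).2 (Eventually.of_forall fun x => ?_)
      simp [hmean i]
    rw [h2, covariance_comm, hcov] at h
    exact h.symm
  -- Orthogonality of the spanned lines needs no normalisation, so the case `v = 0` is included.
  have horth : OrthogonalFamily ℝ (fun k => ℝ ∙ g k) fun k => (ℝ ∙ g k).subtypeₗᵢ := by
    refine OrthogonalFamily.of_pairwise fun i j hij => ?_
    refine Submodule.isOrtho_span.2 ?_
    rintro _ rfl _ rfl
    rw [hinner, if_neg hij]
  have hsum : Summable fun k => a k • g k := by
    have := (horth.summable_iff_norm_sq_summable fun k =>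
      ⟨a k • g k, Submodule.smul_mem _ _ (Submodule.mem_span_singleton_self _)⟩).2 ?_
    · exact this
    · refine (ha.mul_right v).congr fun k => ?_
      have hk : ‖g k‖ ^ 2 = v := by rw [← real_inner_self_eq_norm_sq, hinner, if_pos rfl]
      rw [Submodule.coe_norm, norm_smul, mul_pow, hk, Real.norm_eq_abs, sq_abs]
  set Y : Lp ℝ 2 P := ∑' k, a k • g k with hY
  have hS : ∀ᵐ x ∂P, ∀ n, (∑ k ∈ range n, a k • g k : Lp ℝ 2 P) x =
      ∑ k ∈ range n, a k * G k x := by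
    have h1 : ∀ᵐ x ∂P, ∀ k, g k x = G k x := ae_all_iff.2 fun k => (hG k).coeFn_toLp
    have h2 : ∀ᵐ x ∂P, ∀ k, (a k • g k : Lp ℝ 2 P) x = a k * g k x :=
      ae_all_iff.2 fun k => Lp.coeFn_smul _ _
    have h3 : ∀ᵐ x ∂P, ∀ n, (∑ k ∈ range n, a k • g k : Lp ℝ 2 P) x =
        ∑ k ∈ range n, (a k • g k : Lp ℝ 2 P) x :=
      ae_all_iff.2 fun n => Lp.coeFn_fun_finsetSum _ _
    filter_upwards [h1, h2, h3] with x e1 e2 e3 n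
    rw [e3]
    exact Finset.sum_congr rfl fun k _ => by rw [e2, e1]
  -- A subsequence of the L² convergent partial sums converges almost everywhere, which identifies
  -- the L² limit with `L`.
  obtain ⟨ns, hns, hlim⟩ :=
    (tendstoInMeasure_of_tendsto_Lp hsum.hasSum.tendsto_sum_nat).exists_seq_tendsto_ae
  have hLY : L =ᵐ[P] fun x => c + Y x := by
    filter_upwards [hS, hlim, hL] with x e1 e2 e3
    have h1 := e3.comp hns.tendsto_atTop
    have h2 := e2.const_add c
    simp only [e1] at h2
    exact tendsto_nhds_unique h1 h2
  have hYm : MemLp Y 2 P := Lp.memLp Y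
  refine ⟨(memLp_congr_ae hLY).2 ((memLp_const c).add hYm), fun W hW => ?_⟩
  have hcovL : cov[L, W; P] = cov[Y, W; P] := by
    rw [covariance_congr_ae hLY (ae_eq_refl W)]
    exact covariance_const_add_left (hYm.integrable (by norm_num)) c
  rw [hcovL, covariance_eq_inner hYm hW, Lp.toLp_coeFn]
  have h := hsum.hasSum.mapL
    (innerSL ℝ ((hW.sub (memLp_const (∫ x, W x ∂P))).toLp _))
  refine h.congr_fun fun k => ?_
  rw [covariance_eq_inner (hG k) hW, innerSL_apply_apply, real_inner_smul_right]

namespace IsSFIEGARCH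

section Moments

variable (hX : IsSFIEGARCH P α β s d ω θ γ Z σ X)
include hX

theorem memLp_gInnov (t : ℤ) : MemLp (gInnov P θ γ Z t) 2 P := by
  have h : MemLp (Z t) 2 P := (hX.identDistrib_Z t).symm.memLp_snd hX.memLp_Z
  exact (h.const_mul θ).add ((h.abs.sub (memLp_const _)).const_mul γ)

theorem integral_gInnov (t : ℤ) : ∫ x, gInnov P θ γ Z t x ∂P = 0 := by
  have hm : MemLp (Z t) 2 P := (hX.identDistrib_Z t).symm.memLp_snd hX.memLp_Z
  have h : Integrable (Z t) P := hm.integrable (by norm_num)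
  have h0 : ∫ x, Z t x ∂P = 0 := by rw [(hX.identDistrib_Z t).integral_eq, hX.mean_Z]
  simp only [gInnov]
  have hc : Integrable (fun x => |Z t x| - ∫ y, |Z t y| ∂P) P := h.abs.sub (integrable_const _)
  have hc0 : ∫ x, (|Z t x| - ∫ y, |Z t y| ∂P) ∂P = 0 := by
    rw [integral_sub h.abs (integrable_const _)]
    simp
  rw [integral_add (h.const_mul θ) (hc.const_mul γ), integral_const_mul, integral_const_mul,
    hc0, h0, mul_zero, mul_zero, add_zero]

theorem variance_gInnov_zero : cov[gInnov P θ γ Z 0, gInnov P θ γ Z 0; P] = sigmaGSq P θ γ Z := by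
  have hm := hX.memLp_gInnov 0
  rw [covariance_eq_sub hm hm, hX.integral_gInnov, mul_zero, sub_zero]
  have hZ := hX.memLp_Z
  have i1 : Integrable (Z 0) P := hZ.integrable (by norm_num)
  have i2 : Integrable (fun x => Z 0 x ^ 2) P := hZ.integrable_sq
  have i3 : Integrable (fun x => Z 0 x * |Z 0 x|) P := hZ.integrable_mul hZ.abs
  have hsq : ∫ x, Z 0 x ^ 2 ∂P = 1 := by
    have h := hX.variance_Z
    rwa [variance_of_integral_eq_zero i1.aemeasurable hX.mean_Z] at h
  set m := ∫ x, |Z 0 x| ∂P with hm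
  have hexp : ∀ x, (gInnov P θ γ Z 0 * gInnov P θ γ Z 0) x =
      (θ ^ 2 + γ ^ 2) * Z 0 x ^ 2 + (-2 * γ ^ 2 * m) * |Z 0 x| + γ ^ 2 * m ^ 2 +
        2 * θ * γ * (Z 0 x * |Z 0 x|) + (-2 * θ * γ * m) * Z 0 x := by
    intro x
    simp only [Pi.mul_apply, gInnov]
    rw [← hm]
    have := sq_abs (Z 0 x)
    linear_combination γ ^ 2 * this
  rw [integral_congr_ae (Eventually.of_forall hexp)]
  have j1 := i2.const_mul (θ ^ 2 + γ ^ 2)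
  have j2 := i1.abs.const_mul (-2 * γ ^ 2 * m)
  have j3 : Integrable (fun _ : Ω => γ ^ 2 * m ^ 2) P := integrable_const _
  have j4 := i3.const_mul (2 * θ * γ)
  have j5 := i1.const_mul (-2 * θ * γ * m)
  rw [integral_add (by exact ((j1.add j2).add j3).add j4) j5,
    integral_add (by exact (j1.add j2).add j3) j4, integral_add (by exact j1.add j2) j3,
    integral_add j1 j2]
  simp only [integral_const_mul, hsq, hX.mean_Z, integral_const, probReal_univ, one_smul]
  rw [← hm, sigmaGSq]
  ring

theorem covariance_gInnov (t u : ℤ) :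
    cov[gInnov P θ γ Z t, gInnov P θ γ Z u; P] = if t = u then sigmaGSq P θ γ Z else 0 := by
  split_ifs with h
  · subst h
    rw [← hX.variance_gInnov_zero,
      covariance_self (hX.memLp_gInnov t).aestronglyMeasurable.aemeasurable,
      covariance_self (hX.memLp_gInnov 0).aestronglyMeasurable.aemeasurable, hX.gInnov_eq t,
      hX.gInnov_eq 0]
    exact ((hX.identDistrib_Z t).comp (measurable_innovFun _ _ _)).variance_eq
  · refine IndepFun.covariance_eq_zero ?_ (hX.memLp_gInnov t) (hX.memLp_gInnov u)
    rw [hX.gInnov_eq t, hX.gInnov_eq u]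
    exact (hX.indep_Z.indepFun h).comp (measurable_innovFun _ _ _) (measurable_innovFun _ _ _)

theorem covariance_gInnov_logSq (hlog : MemLp (logSq Z 0) 2 P) (t u : ℤ) :
    cov[gInnov P θ γ Z t, logSq Z u; P] = if t = u then covGLog P θ γ Z else 0 := by
  split_ifs with h
  · subst h
    have hpair : ∀ t, cov[gInnov P θ γ Z t, logSq Z t; P] =
        ∫ x, (gInnov P θ γ Z t * logSq Z t) x ∂P := fun t => by
      rw [covariance_eq_sub (hX.memLp_gInnov t) (hX.memLp_logSq_Z hlog t), hX.integral_gInnov,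
        zero_mul, sub_zero]
    rw [covGLog, hpair t, hpair 0, hX.gInnov_eq t, hX.gInnov_eq 0]
    exact ((hX.identDistrib_Z t).comp
      ((measurable_innovFun θ γ (∫ y, |Z 0 y| ∂P)).mul measurable_log_sq)).integral_eq
  · refine IndepFun.covariance_eq_zero ?_ (hX.memLp_gInnov t) (hX.memLp_logSq_Z hlog u)
    rw [hX.gInnov_eq t]
    exact (hX.indep_Z.indepFun h).comp (measurable_innovFun _ _ _) measurable_log_sq

section Volatility

variable (hlam : Summable fun k => lamCoeff α β s d k ^ 2)
include hlam

theorem logSq_sigma (t : ℤ) :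
    MemLp (logSq σ t) 2 P ∧ ∀ W, MemLp W 2 P →
      HasSum (fun k : ℕ => lamCoeff α β s d k * cov[gInnov P θ γ Z (t - 1 - (k : ℤ)), W; P])
        cov[logSq σ t, W; P] := by
  refine memLp_of_tendsto_orthogonal_series (v := sigmaGSq P θ γ Z) (c := ω)
    (fun k => hX.memLp_gInnov _) (fun k => hX.integral_gInnov _) (fun i j => ?_) hlam
    (hX.log_sigma_sq t)
  rw [hX.covariance_gInnov]
  simp only [sub_right_inj, Nat.cast_inj]

theorem covariance_logSq_sigma_gInnov (t : ℤ) (n : ℕ) :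
    cov[logSq σ t, gInnov P θ γ Z (t - 1 - (n : ℤ)); P] =
      sigmaGSq P θ γ Z * lamCoeff α β s d n := by
  have h := (hX.logSq_sigma hlam t).2 _ (hX.memLp_gInnov (t - 1 - (n : ℤ)))
  simp only [hX.covariance_gInnov, sub_right_inj, Nat.cast_inj] at h
  have h2 := hasSum_single (f := fun k => lamCoeff α β s d k *
    if k = n then sigmaGSq P θ γ Z else 0) n fun k hk => by rw [if_neg hk, mul_zero]
  rw [if_pos rfl] at h2
  rw [h.unique h2, mul_comm]

theorem covariance_logSq_sigma (t : ℤ) (n : ℕ) :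
    cov[logSq σ t, logSq σ (t + n); P] = sigmaGSq P θ γ Z * lamCorr α β s d n := by
  have h := (hX.logSq_sigma hlam t).2 _ (hX.logSq_sigma hlam (t + n)).1
  rw [← h.tsum_eq, lamCorr, ← tsum_mul_left]
  refine tsum_congr fun k => ?_
  -- The `k`-th innovation of `ln σ_t²` is the `(k + n)`-th of `ln σ_{t+n}²`.
  have h2 := hX.covariance_logSq_sigma_gInnov hlam (t + n) (k + n)
  have e : t + (n : ℤ) - 1 - ((k + n : ℕ) : ℤ) = t - 1 - k := by push_cast; ring
  rw [covariance_comm, ← e, h2]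
  ring

/-- `Z_t` enters `ln σ²` at time `t + n + 1` as innovation number `n`; hence the index `n - 1` at
lag `n`. -/
theorem covariance_logSq_sigma_Z (hlog : MemLp (logSq Z 0) 2 P) (t : ℤ) (n : ℕ) :
    cov[logSq σ (t + (n + 1 : ℕ)), logSq Z t; P] =
      covGLog P θ γ Z * lamCoeff α β s d n := by
  have h := (hX.logSq_sigma hlam (t + (n + 1 : ℕ))).2 _ (hX.memLp_logSq_Z hlog t)
  have e : ∀ k : ℕ, (t + (n + 1 : ℕ) - 1 - (k : ℤ) = t) ↔ k = n := fun k => by omega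
  simp only [hX.covariance_gInnov_logSq hlog, e] at h
  have h2 := hasSum_single (f := fun k => lamCoeff α β s d k *
    if k = n then covGLog P θ γ Z else 0) n fun k hk => by rw [if_neg hk, mul_zero]
  rw [if_pos rfl] at h2
  rw [h.unique h2, mul_comm]

/-- The volatility at time `t` involves only innovations before `t`. -/
theorem covariance_logSq_sigma_Z_of_le (hlog : MemLp (logSq Z 0) 2 P) {t u : ℤ} (htu : t ≤ u) :
    cov[logSq σ t, logSq Z u; P] = 0 := by
  have h := (hX.logSq_sigma hlam t).2 _ (hX.memLp_logSq_Z hlog u)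
  have e : ∀ k : ℕ, ¬ (t - 1 - (k : ℤ) = u) := fun k => by omega
  simp only [hX.covariance_gInnov_logSq hlog, e, if_false, mul_zero] at h
  exact h.unique hasSum_zero

theorem memLp_logSq_X (hZ_ne : ∀ᵐ x ∂P, Z 0 x ≠ 0) (hlog : MemLp (logSq Z 0) 2 P) (t : ℤ) :
    MemLp (logSq X t) 2 P :=
  (memLp_congr_ae (hX.logSq_X_ae hZ_ne t)).2
    ((hX.logSq_sigma hlam t).1.add (hX.memLp_logSq_Z hlog t))

/-- The autocovariances of `ln X_t²` at positive lags. -/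
theorem autocov_logSq_X (hZ_ne : ∀ᵐ x ∂P, Z 0 x ≠ 0) (hlog : MemLp (logSq Z 0) 2 P) (t : ℤ)
    {n : ℕ} (hn : 0 < n) :
    autocov P (logSq X) t n = sigmaGSq P θ γ Z * lamCorr α β s d n +
      covGLog P θ γ Z * lamCoeff α β s d (n - 1) := by
  obtain ⟨k, rfl⟩ : ∃ k, n = k + 1 := ⟨n - 1, by omega⟩
  have s1 := fun u => (hX.logSq_sigma hlam u).1
  have z1 := hX.memLp_logSq_Z hlog
  rw [autocov, covariance_congr_ae (hX.logSq_X_ae hZ_ne t) (hX.logSq_X_ae hZ_ne _),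
    covariance_add_left (s1 t) (z1 t) ((s1 _).add (z1 _)),
    covariance_add_right (s1 t) (s1 _) (z1 _), covariance_add_right (z1 t) (s1 _) (z1 _),
    hX.covariance_logSq_sigma hlam t (k + 1),
    hX.covariance_logSq_sigma_Z_of_le hlam hlog (by omega),
    hX.covariance_logSq_Z hlog (by omega), covariance_comm (X := logSq Z t),
    hX.covariance_logSq_sigma_Z hlam hlog t k]
  simp

end Volatility

end Moments

end IsSFIEGARCH

end Probability

/-- Zero variance forces `g(Z_0) = 0` almost surely. This settles the degenerate case for `d > 0`.
-/
theorem IsSFIEGARCH.covGLog_eq_zero {Ω : Type*} [MeasurableSpace Ω] {P : Measure Ω}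
    [IsProbabilityMeasure P] {α β : Polynomial ℝ} {s : ℕ} {d ω θ γ : ℝ} {Z σ X : ℤ → Ω → ℝ}
    (hX : IsSFIEGARCH P α β s d ω θ γ Z σ X) (hv : sigmaGSq P θ γ Z = 0) :
    covGLog P θ γ Z = 0 := by
  have hm := hX.memLp_gInnov 0
  have h0 := hX.variance_gInnov_zero
  rw [hv, covariance_self hm.aestronglyMeasurable.aemeasurable,
    variance_of_integral_eq_zero hm.aestronglyMeasurable.aemeasurable (hX.integral_gInnov 0)] at h0
  have h1 := (integral_eq_zero_iff_of_nonneg (fun x => sq_nonneg (gInnov P θ γ Z 0 x))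
    hm.integrable_sq).1 h0
  have h2 : gInnov P θ γ Z 0 =ᵐ[P] fun _ => 0 := by
    filter_upwards [h1] with x hx
    exact pow_eq_zero_iff two_ne_zero |>.1 hx
  rw [covGLog, covariance_congr_ae h2 (ae_eq_refl _)]
  exact covariance_const_left 0

/-! ### The two asymptotic regimes -/

section Asymptotic

variable {Ω : Type*} [MeasurableSpace Ω] {P : Measure Ω} [IsProbabilityMeasure P]
  {α β : Polynomial ℝ} {s : ℕ} {d ω θ γ : ℝ} {Z σ X : ℤ → Ω → ℝ}

theorem IsSFIEGARCH.sum_autocov_eventuallyEq (hX : IsSFIEGARCH P α β s d ω θ γ Z σ X)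
    (hlam : Summable fun k => lamCoeff α β s d k ^ 2) (hZ_ne : ∀ᵐ x ∂P, Z 0 x ≠ 0)
    (hlog : MemLp (logSq Z 0) 2 P) (t : ℤ) :
    ∀ᶠ h : ℕ in atTop, sigmaGSq P θ γ Z * (∑ r ∈ range s, lamCorr α β s d (s * h + r)) +
        covGLog P θ γ Z * (∑ r ∈ range s, lamCoeff α β s d (s * h + r - 1)) =
      ∑ r ∈ range s, autocov P (logSq X) t (((s * h + r : ℕ) : ℤ)) := by
  -- For `h > 0` all lags of the block are positive, so the variance at lag `0` never enters.
  filter_upwards [eventually_gt_atTop 0] with h hh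
  rw [Finset.mul_sum, Finset.mul_sum, ← Finset.sum_add_distrib]
  refine Finset.sum_congr rfl fun r _ => (hX.autocov_logSq_X hlam hZ_ne hlog t ?_).symm
  have := Nat.mul_pos hX.s_pos hh
  omega

theorem IsSFIEGARCH.sum_autocov_isEquivalent_of_neg (hX : IsSFIEGARCH P α β s d ω θ γ Z σ X)
    (hZ_ne : ∀ᵐ x ∂P, Z 0 x ≠ 0) (hlog : MemLp (logSq Z 0) 2 P) (hα : α.eval 1 ≠ 0)
    (hd : d < 0) (hdn : ∀ n : ℕ, d ≠ -(n : ℝ)) (hC : covGLog P θ γ Z ≠ 0) (t : ℤ) :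
    Asymptotics.IsEquivalent atTop
      (fun h : ℕ => ∑ r ∈ range s, autocov P (logSq X) t (((s * h + r : ℕ) : ℤ)))
      (fun h : ℕ => covGLog P θ γ Z * calC2 α β s d h * (h : ℝ) ^ (d - 1)) := by
  obtain ⟨R, hR, hf⟩ := exists_summable_fCoeff (α := α) hX.beta_zero hX.beta_ne_zero
  have hs := hX.s_pos
  have hlam := summable_lamCoeff_sq (d := d) hs hR hf (by linarith)
  have hG : Real.Gamma d ≠ 0 := Real.Gamma_ne_zero hdn
  have hF := tsum_fCoeff_ne_zero hX.beta_zero (summable_abs_fCoeff hR hf) hα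
  have h1 := (((hasRate_sum_lamCorr_of_neg hs hR hf hd).const_mul (sigmaGSq P θ γ Z)).add
    ((hasRate_sum_lamCoeff_pred (d := d) hs hR hf (by linarith)).const_mul
      (covGLog P θ γ Z))).congr' (hX.sum_autocov_eventuallyEq hlam hZ_ne hlog t)
  rw [mul_zero, zero_add] at h1
  have h2 := h1.isEquivalent (mul_ne_zero hC (mul_ne_zero (inv_ne_zero hG) hF))
    ((tendsto_calC2 hs hR hf (by linarith) hG).const_mul (covGLog P θ γ Z))
  rwa [neg_sub] at h2

theorem IsSFIEGARCH.sum_autocov_isEquivalent_of_pos (hX : IsSFIEGARCH P α β s d ω θ γ Z σ X)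
    (hZ_ne : ∀ᵐ x ∂P, Z 0 x ≠ 0) (hlog : MemLp (logSq Z 0) 2 P) (hα : α.eval 1 ≠ 0)
    (hd0 : 0 < d) (hd : d < 1 / 2) (t : ℤ) :
    Asymptotics.IsEquivalent atTop
      (fun h : ℕ => ∑ r ∈ range s, autocov P (logSq X) t (((s * h + r : ℕ) : ℤ)))
      (fun h : ℕ => calC1 (sigmaGSq P θ γ Z) α β s d h * (h : ℝ) ^ (2 * d - 1)) := by
  obtain ⟨R, hR, hf⟩ := exists_summable_fCoeff (α := α) hX.beta_zero hX.beta_ne_zero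
  have hs := hX.s_pos
  have hlam := summable_lamCoeff_sq (d := d) hs hR hf hd
  have heq := hX.sum_autocov_eventuallyEq hlam hZ_ne hlog t
  -- If `σ_g² = 0` then also `C₁ = 0`, and both sides are eventually zero; the limit argument needs
  -- a nonzero constant.
  by_cases hv : sigmaGSq P θ γ Z = 0
  · simp only [hv, hX.covGLog_eq_zero hv, calC1, zero_mul, add_zero] at heq ⊢
    exact Asymptotics.IsEquivalent.refl.congr_left heq
  have hF := tsum_fCoeff_ne_zero hX.beta_zero (summable_abs_fCoeff hR hf) hα
  have hG : 0 < Real.Gamma (1 - 2 * d) / (Real.Gamma (1 - d) * Real.Gamma d) :=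
    div_pos (Real.Gamma_pos_of_pos (by linarith))
      (mul_pos (Real.Gamma_pos_of_pos (by linarith)) (Real.Gamma_pos_of_pos hd0))
  have h1 := (((hasRate_sum_lamCorr_of_pos hs hR hf hd0 hd).const_mul (sigmaGSq P θ γ Z)).add
    (((hasRate_sum_lamCoeff_pred (d := d) hs hR hf (by linarith)).of_lt
      (by linarith : 1 - 2 * d < 1 - d)).const_mul (covGLog P θ γ Z))).congr' heq
  rw [mul_zero, add_zero, ← mul_assoc] at h1
  have h2 := h1.isEquivalent (mul_ne_zero (mul_ne_zero hv hG.ne') (pow_ne_zero 2 hF))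
    (tendsto_calC1 hs hR hf hv hd0 hd)
  rwa [neg_sub] at h2

end Asymptotic

end SFIEGARCH

theorem mainTheorem8 {Ω : Type*} [MeasurableSpace Ω] (P : Measure Ω) [IsProbabilityMeasure P]
    (α β : Polynomial ℝ) (s : ℕ) (d ω θ γ : ℝ) (Z σ X : ℤ → Ω → ℝ)
    (hX : SFIEGARCH.IsSFIEGARCH P α β s d ω θ γ Z σ X)
    (hd : d < 1 / 2)
    (hθγ : ¬ (θ = 0 ∧ γ = 0))
    (hZ_ne : ∀ᵐ x ∂P, Z 0 x ≠ 0)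
    (hZ_log : MemLp (SFIEGARCH.logSq Z 0) 2 P)
    (hα : α.eval 1 ≠ 0) :
    (∀ t : ℤ, MemLp (SFIEGARCH.logSq X t) 2 P) ∧
    (d < 0 → (∀ n : ℕ, d ≠ -(n : ℝ)) → SFIEGARCH.covGLog P θ γ Z ≠ 0 → ∀ t : ℤ,
      Asymptotics.IsEquivalent Filter.atTop
        (fun h : ℕ => ∑ r ∈ Finset.range s,
          SFIEGARCH.autocov P (SFIEGARCH.logSq X) t (((s * h + r : ℕ) : ℤ)))
        (fun h : ℕ => SFIEGARCH.covGLog P θ γ Z * SFIEGARCH.calC2 α β s d h *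
          (h : ℝ) ^ (d - 1))) ∧
    (0 < d → ∀ t : ℤ,
      Asymptotics.IsEquivalent Filter.atTop
        (fun h : ℕ => ∑ r ∈ Finset.range s,
          SFIEGARCH.autocov P (SFIEGARCH.logSq X) t (((s * h + r : ℕ) : ℤ)))
        (fun h : ℕ => SFIEGARCH.calC1 (SFIEGARCH.sigmaGSq P θ γ Z) α β s d h *
          (h : ℝ) ^ (2 * d - 1))) := by
  refine ⟨fun t => ?_, fun hd0 hdn hC t =>
    hX.sum_autocov_isEquivalent_of_neg hZ_ne hZ_log hα hd0 hdn hC t,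
    fun hd0 t => hX.sum_autocov_isEquivalent_of_pos hZ_ne hZ_log hα hd0 hd t⟩
  obtain ⟨R, hR, hf⟩ :=
    SFIEGARCH.exists_summable_fCoeff (α := α) hX.beta_zero hX.beta_ne_zero
  exact hX.memLp_logSq_X (SFIEGARCH.summable_lamCoeff_sq hX.s_pos hR hf hd) hZ_ne hZ_log t
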